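/- Let $n\ge 3$, let $G=\mathrm{PSL}(2,\mathbb R)$ act on the upper half-plane $\mathbb H$ by Möbius transformations, and let $\pi_1(\Sigma_n)=\langle c_1,\dots,c_n : c_1c_2\cdots c_n=1\rangle$ be the fundamental group of the $n$-punctured sphere. Let $\alpha=(\alpha_1,\dots,\alpha_n)\in(0,2\pi)^n$ satisfy $\lambda:=\sum_{i=1}^n\alpha_i-2\pi(n-1)>0$. A homomorphism $\phi:\pi_1(\Sigma_n)\to G$ is a Deroin–Tholozan representation (for $\alpha$) if every $\phi(c_i)$ is elliptic with (anti-clockwise) angle of rotation $\alpha_i$ and the volume of $\phi$ is $-\lambda$; here the volume is $j^{-1}(\phi^\star\kappa)\frown[\pi_1(\Sigma_n),\partial\pi_1(\Sigma_n)]$, where $\kappa$ is the bounded class of the cocycle sending $(A_1,A_2)$ to the signed area of the triangle $(z,A_1z,A_1A_2z)$ (clockwise triangles having positive signed area), $j:H^2_b(\pi_1(\Sigma_n),\partial\pi_1(\Sigma_n);\mathbb R)\to H^2_b(\pi_1(\Sigma_n);\mathbb R)$ is the canonical isomorphism, and the fundamental class is that of $(e,c_1,\dots,c_n)$ with $e=(c_1,c_2)+(c_1c_2,c_3)+\dots+(c_1\cdots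 c_{n-1},c_n)+(1,1)$. Put $b_i:=c_{i+1}^{-1}c_i^{-1}\cdots c_1^{-1}$ for $1\le i\le n-3$. Let $\mathrm{ChTri}_\alpha\subset(\mathbb H^n\times\mathbb H^{n-3})/G$ be the set of isometry classes of configurations of fixed points $(C_1,\dots,C_n,B_1,\dots,B_{n-3})$ of the elliptic elements $\phi(c_1),\dots,\phi(c_n),\phi(b_1),\dots,\phi(b_{n-3})$, where $\phi$ runs over the Deroin–Tholozan representations for $\alpha$. **Lemma.** Let $(C_1,\dots,C_n,B_1,\dots,B_{n-3})\in\mathbb H^n\times\mathbb H^{n-3}$, and put $B_0:=C_1$, $B_{n-2}:=C_n$. For $i=0,\dots,n-3$ let $\Delta_i$ be the geodesic triangle with vertices $B_i,C_{i+2},B_{i+1}$, taken in this order, and let $[\Delta_i]\ge 0$ be its hyperbolic area. Put $\beta_0:=2\pi-\alpha_1$, $\beta_{n-2}:=\alpha_n$ and, for $i=0,\dots,n-4$, $$\beta_{i+1}:=\sum_{j=0}^{i}2[\Delta_j]-\sum_{j=1}^{i+2}\alpha_j+2(i+2)\pi .$$ The isometry class of $(C_1,\dots,C_n,B_1,\dots,B_{n-3})$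 lies in $\mathrm{ChTri}_\alpha$ if and only if the following conditions hold. 1. For every $i$ with $[\Delta_i]>0$, the triangle $\Delta_i$ is clockwise oriented and has interior angle $\beta_i/2$ at $B_i$, $\pi-\alpha_{i+2}/2$ at $C_{i+2}$ and $\pi-\beta_{i+1}/2$ at $B_{i+1}$. (For $i=0$ the angle at $B_0=C_1$ is thus $\pi-\alpha_1/2$, and for $i=n-3$ the angle at $B_{n-2}=C_n$ is $\pi-\alpha_n/2$.) 2. For every $i$ with $[\Delta_i]=0$, one has $B_i=C_{i+2}=B_{i+1}$. 3. If $[\Delta_{n-3}]=0$, then $\alpha_{n-1}+\alpha_n-\beta_{n-3}=2\pi$. Moreover, when these conditions hold, there is exactly one $G$-conjugacy class of Deroin–Tholozan representations for $\alpha$ whose fixed points (of $\phi(c_1),\dots,\phi(c_n),\phi(b_1),\dots,\phi(b_{n-3})$) form a configuration isometric to the given one. (Isometric means in the same $G$-orbit.) -/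

import Mathlib

noncomputable section

namespace DeroinTholozan

open MeasureTheory
open scoped UpperHalfPlane MatrixGroups

/-! ### The group `G = PSL(2, ℝ)` acting on the upper half-plane by Möbius transformations -/

/-- The group `G = PSL(2, ℝ)`. -/
abbrev G : Type := PSL(2, ℝ)

/-- A central element of `SL(2, ℝ)` is `± 1`, so it acts trivially on the upper half-plane. -/
theorem center_le_ker :
    Subgroup.center SL(2, ℝ) ≤ (MulAction.toPermHom SL(2, ℝ) ℍ).ker := by
  intro g hg
  rw [MonoidHom.mem_ker]
  ext1 z
  rw [Matrix.SpecialLinearGroup.mem_center_iff] at hg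
  obtain ⟨r, hr, hg⟩ := hg
  have h2 : r ^ 2 = 1 := by simpa using hr
  have hr0 : r ≠ 0 := by rintro rfl; norm_num at h2
  have e00 : g 0 0 = r := by rw [← hg]; simp
  have e01 : g 0 1 = 0 := by rw [← hg]; simp
  have e10 : g 1 0 = 0 := by rw [← hg]; simp
  have e11 : g 1 1 = r := by rw [← hg]; simp
  ext1
  have hrc : (r : ℂ) ≠ 0 := by exact_mod_cast hr0
  simp [UpperHalfPlane.coe_specialLinearGroup_apply, e00, e01, e10, e11, hrc]

/-- The homomorphism from `PSL(2, ℝ)` to the permutations of the upper half-plane. -/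
def toPerm : G →* Equiv.Perm ℍ :=
  QuotientGroup.lift (Subgroup.center SL(2, ℝ)) (MulAction.toPermHom SL(2, ℝ) ℍ) center_le_ker

/-- The action of `PSL(2, ℝ)` on the upper half-plane: `± (a b; c d) • z = (a z + b) / (c z + d)`. -/
instance : MulAction G ℍ := MulAction.compHom ℍ toPerm

theorem mk_smul (g : SL(2, ℝ)) (z : ℍ) : ((g : G) • z : ℍ) = g • z := rfl

/-- An element of `G` is elliptic if it has a unique fixed point in the upper half-plane. -/
def IsElliptic (A : G) : Prop := ∃! z : ℍ, A • z = z

/-- `A` is elliptic and `z` is its fixed point. -/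
def IsFixOf (z : ℍ) (A : G) : Prop := IsElliptic A ∧ A • z = z

/-- The anti-clockwise rotation of angle `θ` around the imaginary unit. -/
def rot (θ : ℝ) : G :=
  QuotientGroup.mk (s := Subgroup.center SL(2, ℝ))
    ⟨!![Real.cos (θ / 2), Real.sin (θ / 2); -Real.sin (θ / 2), Real.cos (θ / 2)], by
      rw [Matrix.det_fin_two_of]; nlinarith [Real.sin_sq_add_cos_sq (θ / 2)]⟩

/-- `A` is elliptic with angle of rotation `θ ∈ (0, 2π)`: it is conjugate to `rot θ`. -/
def HasAngle (A : G) (θ : ℝ) : Prop := θ ∈ Set.Ioo 0 (2 * Real.pi) ∧ IsConj (rot θ) A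

/-! ### Geodesic triangles -/

/-- The geodesic segment between two points. -/
def segment (a b : ℍ) : Set ℍ := {p | dist a p + dist p b = dist a b}

/-- The (filled) geodesic triangle with vertices `a`, `b`, `c`: the union of the geodesic segments
from `a` to the points of the opposite side. -/
def triangle (a b c : ℍ) : Set ℍ := ⋃ q ∈ segment b c, segment a q

/-- The hyperbolic area of a geodesic triangle, for the measure `dx dy / y ^ 2`. -/
def area (a b c : ℍ) : ℝ := (volume : Measure ℍ).real (triangle a b c)

/-- For `b ≠ a`, a positive multiple of the initial velocity at `a` of the geodesic from `a` to `b`.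
Indeed `z ↦ (z - a) / (z - conj a)` maps the upper half-plane onto the unit disc, sends `a` to `0` and
the geodesics through `a` to diameters, and its derivative at `a` is a positive multiple of `-i`. -/
def direction (a b : ℍ) : ℂ :=
  Complex.I * (((b : ℂ) - (a : ℂ)) / ((b : ℂ) - (starRingEnd ℂ) (a : ℂ)))

/-- The interior angle at `a` of the geodesic triangle with vertices `a`, `b`, `c`
(for `b ≠ a` and `c ≠ a`). -/
def interiorAngle (a b c : ℍ) : ℝ :=
  InnerProductGeometry.angle (direction a b) (direction a c)

/-- The orientation of the triple `(a, b, c)`: positive if it is anti-clockwise oriented, negative if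
it is clockwise oriented, zero if the points lie on a common geodesic. -/
def orientation (a b c : ℍ) : ℝ := ((starRingEnd ℂ) (direction a b) * direction a c).im

/-- The triangle with vertices `a`, `b`, `c`, in this order, is clockwise oriented. -/
def IsClockwise (a b c : ℍ) : Prop := orientation a b c < 0

/-- The signed area of the oriented geodesic triangle with vertices `a`, `b`, `c`, with the convention
that clockwise oriented triangles have positive area. -/
def signedArea (a b c : ℍ) : ℝ := -(SignType.sign (orientation a b c) : ℝ) * area a b c

/-! ### Representations of the fundamental group of the `n`-punctured sphere -/

/-- The fundamental group of the `n`-punctured sphere, `⟨c₁, …, cₙ : c₁ ⋯ cₙ = 1⟩`. -/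
abbrev SphereGroup (n : ℕ) : Type :=
  PresentedGroup {(List.ofFn (FreeGroup.of : Fin n → FreeGroup (Fin n))).prod}

/-- The generators `c₁, …, cₙ`; here `gen i` is the generator written `c_{i+1}` in the usual numbering. -/
def gen {n : ℕ} (i : Fin n) : SphereGroup n := PresentedGroup.of i

/-- The product `c₁ ⋯ c_j` of the first `j` generators. -/
def genProd {n : ℕ} (j : Fin (n + 1)) : SphereGroup n := Fin.partialProd gen j

/-- The area cocycle on `G`, with base point `i`. -/
def areaCocycle (A B : G) : ℝ :=
  signedArea UpperHalfPlane.I (A • UpperHalfPlane.I) ((A * B) • UpperHalfPlane.I)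

/-- `v` is the volume of the representation `φ`. A relative bounded cocycle representing the preimage,
in the bounded cohomology of the group relative to its peripheral subgroups `⟨cᵢ⟩`, of the pull-back
by `φ` of the bounded area class, consists of the pull-back of the area cocycle together with a bounded
primitive `k i` of its restriction to each `⟨cᵢ⟩`. The volume is its value on the fundamental class, the
class of the relative cycle `(e, c₁, …, cₙ)` with
`e = (c₁, c₂) + (c₁ c₂, c₃) + ⋯ + (c₁ ⋯ c_{n-1}, cₙ) + (1, 1)`. -/
def IsVolume {n : ℕ} (φ : SphereGroup n →* G) (v : ℝ) : Prop :=
  ∃ k : (i : Fin n) → Subgroup.zpowers (gen i) → ℝ,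
    (∀ i, ∃ M : ℝ, ∀ g, |k i g| ≤ M) ∧
    (∀ i, ∀ g h : Subgroup.zpowers (gen i),
      k i h - k i (g * h) + k i g = areaCocycle (φ g) (φ h)) ∧
    v = (∑ i : Fin n with 0 < i.val, areaCocycle (φ (genProd i.castSucc)) (φ (gen i)))
        + areaCocycle (φ 1) (φ 1)
        - ∑ i : Fin n, k i ⟨gen i, Subgroup.mem_zpowers (gen i)⟩

/-- Two representations are equivalent if they are conjugate by an element of `G`. -/
def conjSetoid (n : ℕ) : Setoid (SphereGroup n →* G) where
  r φ ψ := ∃ A : G, ∀ x, ψ x = A * φ x * A⁻¹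
  iseqv :=
    { refl := fun φ => ⟨1, fun x => by simp⟩
      symm := by
        rintro φ ψ ⟨A, h⟩
        exact ⟨A⁻¹, fun x => by rw [h x]; group⟩
      trans := by
        rintro φ ψ χ ⟨A, h⟩ ⟨B, h'⟩
        exact ⟨B * A, fun x => by rw [h' x, h x]; group⟩ }

/-- The character variety (as a set): representations up to conjugation. -/
def Rep (n : ℕ) : Type := Quotient (conjSetoid n)

/-- The conjugacy class of a representation. -/
def Rep.mk {n : ℕ} (φ : SphereGroup n →* G) : Rep n := Quotient.mk (conjSetoid n) φ

/-- The scaling factor `λ = α₁ + ⋯ + αₙ - 2π(n-1)`. -/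
def scalingFactor {n : ℕ} (α : Fin n → ℝ) : ℝ := ∑ i, α i - 2 * Real.pi * ((n : ℝ) - 1)

/-- `φ` is a Deroin-Tholozan representation with angles `α`: each `φ(cᵢ)` is elliptic with angle of
rotation `αᵢ`, and the volume of `φ` is `-λ`. -/
def IsDT {n : ℕ} (α : Fin n → ℝ) (φ : SphereGroup n →* G) : Prop :=
  (∀ i, HasAngle (φ (gen i)) (α i)) ∧ IsVolume φ (-scalingFactor α)

/-- The Deroin-Tholozan relative character variety. -/
def RepDT {n : ℕ} (α : Fin n → ℝ) : Set (Rep n) := {r | ∃ φ, Rep.mk φ = r ∧ IsDT α φ}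

/-! ### Chains of triangles

From here on the number of punctures is `n = m + 3`. -/

/-- Configurations `(C₁, …, Cₙ, B₁, …, B_{n-3})` of points in the upper half-plane, for `n = m + 3`.
The point written `C_{i+1}` in the usual numbering is `x.1 i`, and `B_{j+1}` is `x.2 j`. -/
abbrev Config (m : ℕ) : Type := (Fin (m + 3) → ℍ) × (Fin m → ℍ)

/-- The moduli space of point configurations: configurations up to the diagonal action of `G`. -/
abbrev Moduli (m : ℕ) : Type := MulAction.orbitRel.Quotient G (Config m)

/-- The isometry class of a configuration. -/
def Moduli.mk {m : ℕ} (x : Config m) : Moduli m :=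
  Quotient.mk (MulAction.orbitRel G (Config m)) x

/-- The curve `b_{j+1} = c_{j+2}⁻¹ ⋯ c₁⁻¹ = (c₁ ⋯ c_{j+2})⁻¹`, for `0 ≤ j ≤ n - 4`. -/
def curve {m : ℕ} (j : Fin m) : SphereGroup (m + 3) :=
  (genProd (⟨j.val + 2, by omega⟩ : Fin (m + 3 + 1)))⁻¹

/-- The configuration `x` consists of the fixed points of the elliptic elements
`φ(c₁), …, φ(cₙ), φ(b₁), …, φ(b_{n-3})`. -/
def IsFixConfig {m : ℕ} (φ : SphereGroup (m + 3) →* G) (x : Config m) : Prop :=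
  (∀ i, IsFixOf (x.1 i) (φ (gen i))) ∧ ∀ j, IsFixOf (x.2 j) (φ (curve j))

/-- The (graph of the) map `𝔓` sending the class of a representation `φ` to the isometry class of the
configuration of fixed points of `φ(c₁), …, φ(cₙ), φ(b₁), …, φ(b_{n-3})`. -/
def FixClass {m : ℕ} (r : Rep (m + 3)) (q : Moduli m) : Prop :=
  ∃ φ x, Rep.mk φ = r ∧ Moduli.mk x = q ∧ IsFixConfig φ x

/-- The space of chains of triangles with parameter `α`: the image under `𝔓` of the Deroin-Tholozan
relative character variety. -/
def ChTri {m : ℕ} (α : Fin (m + 3) → ℝ) : Set (Moduli m) := {q | ∃ r ∈ RepDT α, FixClass r q}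

variable {m : ℕ}

/-- The points `B₀, B₁, …, B_{n-2}`, where `B₀ = C₁` and `B_{n-2} = Cₙ`. -/
def ptB (x : Config m) : Fin (m + 2) → ℍ :=
  Fin.cons (x.1 0) (Fin.snoc (α := fun _ => ℍ) x.2 (x.1 (Fin.last (m + 2))))

/-- The point `C_{i+2}`, for `0 ≤ i ≤ n - 3`. -/
def ptC (x : Config m) (i : Fin (m + 1)) : ℍ := x.1 ⟨i.val + 1, by omega⟩

/-- The angle `α_{i+2}`, for `0 ≤ i ≤ n - 3`. -/
def angC (α : Fin (m + 3) → ℝ) (i : Fin (m + 1)) : ℝ := α ⟨i.val + 1, by omega⟩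

/-- The area `[Δ_i]` of the triangle `Δ_i` with vertices `B_i`, `C_{i+2}`, `B_{i+1}`. -/
def chainArea (x : Config m) (i : Fin (m + 1)) : ℝ :=
  area (ptB x i.castSucc) (ptC x i) (ptB x i.succ)

/-- The numbers `β₀, …, β_{n-2}`: one has `β₀ = 2π - α₁`, `β_{n-2} = αₙ` and, for `0 ≤ i ≤ n - 4`,
`β_{i+1} = ∑_{j=0}^{i} 2 [Δ_j] - ∑_{j=1}^{i+2} α_j + 2 (i + 2) π`. -/
def beta (α : Fin (m + 3) → ℝ) (x : Config m) : Fin (m + 2) → ℝ :=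
  Fin.cons (2 * Real.pi - α 0)
    (Fin.snoc (α := fun _ => ℝ)
      (fun i : Fin m =>
        (∑ j : Fin (m + 1) with j.val ≤ i.val, 2 * chainArea x j)
          - (∑ j : Fin (m + 3) with j.val < i.val + 2, α j) + 2 * ((i.val : ℝ) + 2) * Real.pi)
      (α (Fin.last (m + 2))))

/-- The geometric conditions on the chain of triangles of a configuration. -/
structure IsAdmissible (α : Fin (m + 3) → ℝ) (x : Config m) : Prop where
  /-- A triangle of positive area is clockwise oriented and has the prescribed interior angles. Since
  `β₀ = 2π - α₁` and `β_{n-2} = αₙ`, this says that the first triangle has angle `π - α₁ / 2` at `C₁`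
  and the last one has angle `π - αₙ / 2` at `Cₙ`. -/
  nondegenerate : ∀ i : Fin (m + 1), 0 < chainArea x i →
    IsClockwise (ptB x i.castSucc) (ptC x i) (ptB x i.succ) ∧
    interiorAngle (ptB x i.castSucc) (ptC x i) (ptB x i.succ) = beta α x i.castSucc / 2 ∧
    interiorAngle (ptC x i) (ptB x i.succ) (ptB x i.castSucc) = Real.pi - angC α i / 2 ∧
    interiorAngle (ptB x i.succ) (ptB x i.castSucc) (ptC x i) = Real.pi - beta α x i.succ / 2
  /-- A triangle of area zero is reduced to a point. -/
  degenerate : ∀ i : Fin (m + 1), chainArea x i = 0 →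
    ptB x i.castSucc = ptC x i ∧ ptC x i = ptB x i.succ
  /-- End condition at `Cₙ` when the last triangle is reduced to a point, and so has no interior angle
  there: `α_{n-1} + β_{n-2} - β_{n-3} = 2π`, where `β_{n-2} = αₙ`. -/
  closing : chainArea x (Fin.last m) = 0 →
    angC α (Fin.last m) + beta α x (Fin.last m).succ - beta α x (Fin.last m).castSucc = 2 * Real.pi

end DeroinTholozan

end

/-!
# Deroin-Tholozan representations and chains of triangles

An elliptic element of `G` with fixed point `z` and angle `θ` is the class of
`cos (θ / 2) + sin (θ / 2) J_z`, where `J_z` (`complexStr`) is the traceless matrix with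
`J_z ^ 2 = -1` attached to `z`. Put `T_i = φ(c₁ ⋯ c_{i+1})`; it fixes `B_i`, and is the rotation
there of angle `-b_i` for a unique `b_i ∈ (0, 2π)`. A representation with all these elements
elliptic is therefore the same thing as a solution of the equations `T_i φ(c_{i+2}) = T_{i+1}`, each
of which relates three rotations around `B_i`, `C_{i+2}` and `B_{i+1}`.

*One equation.* Lifted to `SL(2, ℝ)`, the equation holds up to a sign. The algebra of the `J_z`
shows that the three centres either coincide or form a nondegenerate triangle, whose orientation is
given by the sign and whose angles are given by the half angles of rotation
(`TriangleRel.eq_or_triDet_neg`, `TriangleRel.interiorAngle_eq`, `triangleRel_or_of_rotAt_mul_eq`),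
and that every clockwise triangle arises in this way (`triangleRel_interiorAngle`). By Gauss-Bonnet
(`TriangleRel.areaForm_eq`) the signed area `S_i` of the triangle satisfies
`2 S_i = α_{i+2} + b_{i+1} - b_i - 2π ε_i`, where `ε_i` is `1` for the clockwise sign and `0` for
the other.

*Area.* The measure of a geodesic triangle is computed in the coordinates `(x, x² + y²)`, in which
geodesic segments are affine segments: up to null sets, a triangle is a signed sum of regions lying
above its sides, and the area above the side `ab` is `2 arctan ((x_b - x_a) / (y_a + y_b))`
(`volume_above_chord`). Hence the signed area is a sum of three terms, one for each side
(`signedArea_eq`), and is a cocycle.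

*Volume.* The bounded primitive of the area cocycle on an elliptic cyclic group is unique: it is the
area of a triangle with a vertex at the fixed point (`isVolume_iff`). Additivity then expresses each
term of the fundamental cycle through these primitives and the area of a kite, made of the triangle
`B_i C_{i+2} B_{i+1}` and its mirror image (`areaForm_hexagon`, `areaForm_reflect`). The primitives
telescope, and the volume is `-2 ∑ S_i` (`isVolume_iff_of_isFixConfig`).

*Conclusion.* Summing `2 S_i = α_{i+2} + b_{i+1} - b_i - 2π ε_i` over the `n - 2` triangles gives
`∑ α_i - 2π - 2π ∑ ε_i`, so the volume is `-λ` if and only if every `ε_i` is `1`. In that case the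
recursion determines `b_i = β_i`, and the conditions on the triangles are those of `IsAdmissible`.
Conversely, an admissible chain gives rotations satisfying all the equations, and a representation
is determined by the fixed points and the angles of the images of the generators.
-/

namespace DeroinTholozan

open MeasureTheory
open scoped UpperHalfPlane MatrixGroups

/-! ### The complex structure at a point, and the invariants of two and three points -/

/-- The matrix `J_z` with `J_z ^ 2 = -1` that generates the rotations around `z`: the element of
`SL(2, ℝ)` acting as the rotation of angle `π` around `z`. -/
noncomputable def complexStr (z : ℍ) : Matrix (Fin 2) (Fin 2) ℝ :=
  !![-(z.re / z.im), (z.re ^ 2 + z.im ^ 2) / z.im; -(1 / z.im), z.re / z.im]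

/-- The hyperbolic cosine of the distance, as a rational function of the coordinates. -/
noncomputable def coshDist (a b : ℍ) : ℝ :=
  (a.re ^ 2 + a.im ^ 2 + b.re ^ 2 + b.im ^ 2 - 2 * a.re * b.re) / (2 * a.im * b.im)

/-- Half the trace of `J_a J_b J_c`, as a rational function of the coordinates (see
`triDet_eq_trace`). It has the sign of the orientation of `(a, b, c)`, and vanishes when the points
lie on a geodesic. -/
noncomputable def triDet (a b c : ℍ) : ℝ :=
  ((b.re - a.re) * (c.re ^ 2 + c.im ^ 2 - a.re ^ 2 - a.im ^ 2)
    - (c.re - a.re) * (b.re ^ 2 + b.im ^ 2 - a.re ^ 2 - a.im ^ 2)) / (2 * a.im * b.im * c.im)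

theorem coshDist_eq (a b : ℍ) : coshDist a b = Real.cosh (dist a b) := by
  have ha := a.im_ne_zero
  have hb := b.im_ne_zero
  rw [UpperHalfPlane.cosh_dist, Complex.dist_eq, ← Complex.normSq_eq_norm_sq, Complex.normSq_apply,
    coshDist]
  simp only [Complex.sub_re, Complex.sub_im, UpperHalfPlane.coe_re, UpperHalfPlane.coe_im]
  field_simp
  ring

theorem coshDist_comm (a b : ℍ) : coshDist a b = coshDist b a := by
  rw [coshDist_eq, coshDist_eq, dist_comm]

theorem one_le_coshDist (a b : ℍ) : 1 ≤ coshDist a b := by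
  rw [coshDist_eq]; exact Real.one_le_cosh _

theorem coshDist_eq_one_iff {a b : ℍ} : coshDist a b = 1 ↔ a = b := by
  rw [coshDist_eq, ← dist_eq_zero (x := a), ← not_iff_not, ← ne_eq (dist a b), ← Real.one_lt_cosh]
  exact ⟨fun h => lt_of_le_of_ne (Real.one_le_cosh _) (Ne.symm h), ne_of_gt⟩

theorem one_lt_coshDist {a b : ℍ} (h : a ≠ b) : 1 < coshDist a b :=
  lt_of_le_of_ne (one_le_coshDist a b) fun h' => h (coshDist_eq_one_iff.1 h'.symm)

theorem triDet_rotate (a b c : ℍ) : triDet b c a = triDet a b c := by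
  have ha := a.im_ne_zero
  have hb := b.im_ne_zero
  have hc := c.im_ne_zero
  simp only [triDet]
  field_simp
  ring

theorem triDet_swap (a b c : ℍ) : triDet b a c = -triDet a b c := by
  have ha := a.im_ne_zero
  have hb := b.im_ne_zero
  have hc := c.im_ne_zero
  simp only [triDet]
  field_simp
  ring

/-- The Gram determinant of three points of the hyperboloid. -/
theorem triDet_sq (a b c : ℍ) : triDet a b c ^ 2 =
    1 + 2 * coshDist a b * coshDist b c * coshDist c a
      - coshDist a b ^ 2 - coshDist b c ^ 2 - coshDist c a ^ 2 := by
  have ha := a.im_ne_zero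
  have hb := b.im_ne_zero
  have hc := c.im_ne_zero
  simp only [triDet, coshDist]
  field_simp
  ring

theorem ext_of_re_im {a b : ℍ} (h : a.re = b.re) (h' : a.im = b.im) : a = b :=
  UpperHalfPlane.ext (Complex.ext h h')

theorem complexStr_injective : Function.Injective complexStr := by
  intro a b h
  have ha := a.im_ne_zero
  have hb := b.im_ne_zero
  have h1 := congrFun (congrFun h 1) 0
  have h2 := congrFun (congrFun h 1) 1
  simp only [complexStr, Matrix.of_apply, Matrix.cons_val', Matrix.cons_val_zero,
    Matrix.cons_val_one, Matrix.cons_val_fin_one] at h1 h2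
  have h3 : a.im = b.im := by field_simp at h1; linarith
  refine ext_of_re_im ?_ h3
  rw [h3] at h2
  field_simp at h2
  exact h2

theorem complexStr_mul_self (z : ℍ) : complexStr z * complexStr z = -1 := by
  have hz := z.im_ne_zero
  ext i j
  fin_cases i <;> fin_cases j <;> simp [complexStr, Matrix.mul_apply] <;> field_simp <;> ring

/-- The hyperbolic law of cosines, together with the corresponding law for the sine. -/
theorem conj_direction_mul (a b c : ℍ) :
    (starRingEnd ℂ) (direction a b) * direction a c =
      (((coshDist a b * coshDist a c - coshDist b c : ℝ) : ℂ) + triDet a b c * Complex.I) /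
        ((1 + coshDist a b) * (1 + coshDist a c) : ℝ) := by
  have ha := a.im_ne_zero
  have hb := b.im_ne_zero
  have hc := c.im_ne_zero
  have hapos := a.im_pos
  have hbpos := b.im_pos
  have hcpos := c.im_pos
  have h1 : ((b : ℂ) - (starRingEnd ℂ) (a : ℂ)) ≠ 0 := by
    intro h; have := congrArg Complex.im h
    simp at this; linarith
  have h2 : ((c : ℂ) - (starRingEnd ℂ) (a : ℂ)) ≠ 0 := by
    intro h; have := congrArg Complex.im h
    simp at this; linarith
  have h5 : (((1 + coshDist a b) * (1 + coshDist a c) : ℝ) : ℂ) ≠ 0 := by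
    have := one_le_coshDist a b
    have := one_le_coshDist a c
    have : 0 < (1 + coshDist a b) * (1 + coshDist a c) := by positivity
    exact_mod_cast this.ne'
  have h1' : ((starRingEnd ℂ) (b : ℂ) - a) ≠ 0 := by
    intro h; apply h1; have := congrArg (starRingEnd ℂ) h; simpa using this
  have key : (starRingEnd ℂ) (direction a b) * direction a c =
      (((starRingEnd ℂ) (b : ℂ) - (starRingEnd ℂ) (a : ℂ)) * (c - a)) /
        (((starRingEnd ℂ) (b : ℂ) - a) * (c - (starRingEnd ℂ) (a : ℂ))) := by
    simp only [direction, map_mul, map_div₀, map_sub, Complex.conj_I, Complex.conj_conj]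
    rw [mul_mul_mul_comm, neg_mul, Complex.I_mul_I, neg_neg, one_mul, div_mul_div_comm]
  rw [key, div_eq_div_iff (mul_ne_zero h1' h2) h5]
  apply Complex.ext
  all_goals
    simp only [Complex.mul_re, Complex.mul_im, Complex.sub_re, Complex.sub_im, Complex.add_re,
      Complex.add_im, Complex.conj_re, Complex.conj_im, Complex.ofReal_re, Complex.ofReal_im,
      Complex.I_re, Complex.I_im, UpperHalfPlane.coe_re, UpperHalfPlane.coe_im, coshDist, triDet]
    field_simp
    ring

/-! ### Orientation and interior angles -/

theorem orientation_eq (a b c : ℍ) :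
    orientation a b c = triDet a b c / ((1 + coshDist a b) * (1 + coshDist a c)) := by
  rw [orientation, conj_direction_mul, Complex.div_ofReal_im]
  simp

theorem one_add_coshDist_mul_pos (a b c : ℍ) : 0 < (1 + coshDist a b) * (1 + coshDist a c) := by
  have := one_le_coshDist a b
  have := one_le_coshDist a c
  positivity

theorem isClockwise_iff {a b c : ℍ} : IsClockwise a b c ↔ triDet a b c < 0 := by
  rw [IsClockwise, orientation_eq, div_neg_iff]
  have := one_add_coshDist_mul_pos a b c
  constructor
  · rintro (h | h)
    · linarith
    · exact h.1
  · exact fun h => Or.inr ⟨h, this⟩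

theorem sign_orientation (a b c : ℍ) :
    SignType.sign (orientation a b c) = SignType.sign (triDet a b c) := by
  rw [orientation_eq, div_eq_mul_inv, sign_mul,
    sign_pos (inv_pos.2 (one_add_coshDist_mul_pos a b c)), mul_one]

/-- The hyperbolic sine of the distance. -/
noncomputable def sinhDist (a b : ℍ) : ℝ := √(coshDist a b ^ 2 - 1)

theorem sinhDist_comm (a b : ℍ) : sinhDist a b = sinhDist b a := by
  rw [sinhDist, sinhDist, coshDist_comm]

theorem sinhDist_sq (a b : ℍ) : sinhDist a b ^ 2 = coshDist a b ^ 2 - 1 := by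
  have := one_le_coshDist a b
  rw [sinhDist, Real.sq_sqrt]
  nlinarith

theorem sinhDist_nonneg (a b : ℍ) : 0 ≤ sinhDist a b := Real.sqrt_nonneg _

theorem sinhDist_pos {a b : ℍ} (h : a ≠ b) : 0 < sinhDist a b := by
  have := one_lt_coshDist h
  exact Real.sqrt_pos.2 (by nlinarith)

theorem sq_sub_add_triDet_sq (a b c : ℍ) :
    (coshDist a b * coshDist a c - coshDist b c) ^ 2 + triDet a b c ^ 2 =
      (sinhDist a b * sinhDist a c) ^ 2 := by
  rw [triDet_sq, mul_pow, sinhDist_sq, sinhDist_sq, coshDist_comm c a]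
  ring

theorem cos_interiorAngle (a b c : ℍ) :
    Real.cos (interiorAngle a b c) * (sinhDist a b * sinhDist a c) =
      coshDist a b * coshDist a c - coshDist b c := by
  have hK := one_add_coshDist_mul_pos a b c
  set K := (1 + coshDist a b) * (1 + coshDist a c) with hKdef
  have h1 := conj_direction_mul a b c
  rw [← hKdef] at h1
  have hnorm : ‖direction a b‖ * ‖direction a c‖ = sinhDist a b * sinhDist a c / K := by
    have h2 : ‖direction a b‖ * ‖direction a c‖ =
        ‖(starRingEnd ℂ) (direction a b) * direction a c‖ := by simp
    rw [h2, h1, norm_div, Complex.norm_real, Real.norm_of_nonneg hK.le, Complex.norm_add_mul_I,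
      sq_sub_add_triDet_sq, Real.sqrt_sq (mul_nonneg (sinhDist_nonneg _ _) (sinhDist_nonneg _ _))]
  have h3 := InnerProductGeometry.cos_angle_mul_norm_mul_norm (direction a b) (direction a c)
  rw [hnorm, Complex.inner, mul_comm (direction a c), h1, Complex.div_ofReal_re] at h3
  simp only [Complex.add_re, Complex.ofReal_re, Complex.mul_re, Complex.I_re, mul_zero,
    Complex.ofReal_im, Complex.I_im, zero_mul, sub_zero, add_zero] at h3
  rw [mul_div_assoc', div_left_inj' hK.ne'] at h3
  exact h3

theorem interiorAngle_mem (a b c : ℍ) : interiorAngle a b c ∈ Set.Icc 0 Real.pi :=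
  ⟨InnerProductGeometry.angle_nonneg _ _, InnerProductGeometry.angle_le_pi _ _⟩

theorem sin_interiorAngle (a b c : ℍ) :
    Real.sin (interiorAngle a b c) * (sinhDist a b * sinhDist a c) = |triDet a b c| := by
  have h1 := cos_interiorAngle a b c
  have h2 := sq_sub_add_triDet_sq a b c
  have h3 := Real.sin_sq_add_cos_sq (interiorAngle a b c)
  have h4 := Real.sin_nonneg_of_mem_Icc (interiorAngle_mem a b c)
  have h5 := mul_nonneg (sinhDist_nonneg a b) (sinhDist_nonneg a c)
  rw [← abs_of_nonneg (mul_nonneg h4 h5), ← sq_eq_sq_iff_abs_eq_abs]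
  rw [← h1] at h2
  linear_combination (sinhDist a b * sinhDist a c) ^ 2 * h3 - h2

/-- An interior angle is determined by its cosine and sine up to a common positive factor. -/
theorem interiorAngle_eq {a b c : ℍ} {p κ : ℝ} (hp : p ∈ Set.Icc 0 Real.pi) (hκ : 0 < κ)
    (hcos : coshDist a b * coshDist a c - coshDist b c = κ * Real.cos p)
    (hsin : |triDet a b c| = κ * Real.sin p) : interiorAngle a b c = p := by
  have h1 := cos_interiorAngle a b c
  have h2 := sq_sub_add_triDet_sq a b c
  have h5 := mul_nonneg (sinhDist_nonneg a b) (sinhDist_nonneg a c)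
  have h6 : κ = sinhDist a b * sinhDist a c := by
    rw [← abs_of_pos hκ, ← abs_of_nonneg h5, ← sq_eq_sq_iff_abs_eq_abs, ← h2,
      ← sq_abs (triDet a b c),
      hcos, hsin]
    linear_combination (-κ ^ 2) * Real.sin_sq_add_cos_sq p
  refine Real.injOn_cos (interiorAngle_mem a b c) hp ?_
  rw [hcos, ← h6, mul_comm] at h1
  exact mul_left_cancel₀ hκ.ne' h1

theorem ne_of_triDet_ne_zero {a b c : ℍ} (h : triDet a b c ≠ 0) : a ≠ b := by
  rintro rfl
  apply h
  simp [triDet]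

/-! ### Lifts of rotations and the relation of a triangle -/

/-- The lift `cos t + sin t J_z` to `2 × 2` matrices of the rotation of angle `2 t` around `z`. -/
noncomputable def rotMat (z : ℍ) (t : ℝ) : Matrix (Fin 2) (Fin 2) ℝ :=
  Real.cos t • 1 + Real.sin t • complexStr z

theorem rotMat_mul (z : ℍ) (s t : ℝ) : rotMat z s * rotMat z t = rotMat z (s + t) := by
  simp only [rotMat, add_mul, mul_add, smul_mul_assoc, mul_smul_comm, complexStr_mul_self, one_mul,
    mul_one, Real.cos_add, Real.sin_add]
  module

theorem rotMat_zero (z : ℍ) : rotMat z 0 = 1 := by simp [rotMat]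

theorem rotMat_add_pi (z : ℍ) (t : ℝ) : rotMat z (t + Real.pi) = -rotMat z t := by
  simp only [rotMat, Real.cos_add_pi, Real.sin_add_pi]; module

theorem rotMat_sub_pi (z : ℍ) (t : ℝ) : rotMat z (t - Real.pi) = -rotMat z t := by
  simp only [rotMat, Real.cos_sub_pi, Real.sin_sub_pi]; module

theorem rotMat_mul_neg (z : ℍ) (t : ℝ) : rotMat z t * rotMat z (-t) = 1 := by
  rw [rotMat_mul, add_neg_cancel, rotMat_zero]

theorem rotMat_neg_mul (z : ℍ) (t : ℝ) : rotMat z (-t) * rotMat z t = 1 := by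
  rw [rotMat_mul, neg_add_cancel, rotMat_zero]

theorem det_rotMat (z : ℍ) (t : ℝ) : (rotMat z t).det = 1 := by
  have hz := z.im_ne_zero
  have := Real.sin_sq_add_cos_sq t
  simp only [rotMat, complexStr, Matrix.det_fin_two, Matrix.add_apply, Matrix.smul_apply,
    Matrix.one_apply, smul_eq_mul, Matrix.of_apply, Matrix.cons_val', Matrix.cons_val_zero,
    Matrix.cons_val_one, Matrix.cons_val_fin_one, if_true, Fin.isValue, zero_ne_one,
    one_ne_zero, if_false]
  field_simp
  linear_combination (z.im ^ 2) * this

/-- The product of the lifts of the rotations around `a`, `b`, `c` by the angles `-2 p`, `-2 q`,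
`-2 r` is `-1`. This holds when `p`, `q`, `r` are the interior angles of the clockwise triangle
`a b c`. -/
def TriangleRel (a b c : ℍ) (p q r : ℝ) : Prop :=
  rotMat a (-p) * rotMat b (-q) * rotMat c (-r) = -1

theorem triangleRel_iff {a b c : ℍ} {p q r : ℝ} :
    TriangleRel a b c p q r ↔ rotMat a (-p) * rotMat b (-q) = -rotMat c r := by
  rw [TriangleRel]
  constructor
  · intro h
    have := congrArg (· * rotMat c r) h
    simpa [mul_assoc, rotMat_neg_mul] using this
  · intro h
    rw [h, neg_mul, rotMat_mul_neg]

theorem TriangleRel.rotate {a b c : ℍ} {p q r : ℝ} (h : TriangleRel a b c p q r) :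
    TriangleRel b c a q r p := by
  have : rotMat a p * (rotMat a (-p) * rotMat b (-q) * rotMat c (-r)) * rotMat a (-p) = -1 := by
    rw [TriangleRel] at h
    rw [h, mul_neg, mul_one, neg_mul, rotMat_mul_neg]
  rw [TriangleRel, ← this, ← mul_assoc, ← mul_assoc, rotMat_mul_neg, one_mul]

/-- The second hyperbolic law of cosines, obtained as the trace of the relation. -/
theorem TriangleRel.cosh {a b c : ℍ} {p q r : ℝ} (h : TriangleRel a b c p q r) :
    Real.sin p * Real.sin q * coshDist a b = Real.cos p * Real.cos q + Real.cos r := by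
  have ha := a.im_ne_zero
  have hb := b.im_ne_zero
  have hc := c.im_ne_zero
  rw [triangleRel_iff] at h
  have h00 := congrFun (congrFun h 0) 0
  have h11 := congrFun (congrFun h 1) 1
  simp [rotMat, complexStr, Matrix.mul_apply, Fin.sum_univ_two] at h00 h11
  simp only [coshDist]
  linear_combination (norm := (field_simp; ring)) (-1 / 2 : ℝ) * (h00 + h11)

/-- The trace of the product of the relation with the commutator of `J_a` and `J_b`. -/
theorem TriangleRel.det {a b c : ℍ} {p q r : ℝ} (h : TriangleRel a b c p q r) :
    Real.sin p * Real.sin q * (coshDist a b ^ 2 - 1) = - (Real.sin r * triDet a b c) := by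
  have ha := a.im_ne_zero
  have hb := b.im_ne_zero
  have hc := c.im_ne_zero
  rw [triangleRel_iff] at h
  have h00 := congrFun (congrFun h 0) 0
  have h11 := congrFun (congrFun h 1) 1
  have h01 := congrFun (congrFun h 0) 1
  have h10 := congrFun (congrFun h 1) 0
  simp [rotMat, complexStr, Matrix.mul_apply, Fin.sum_univ_two] at h00 h11 h01 h10
  simp only [coshDist, triDet]
  linear_combination (norm := (field_simp; ring))
    ((b.re ^ 2 + b.im ^ 2 - a.re ^ 2 - a.im ^ 2) / (4 * a.im * b.im)) * (h00 - h11)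
      + (b.re - a.re) / (2 * a.im * b.im) * h01
      + ((a.re ^ 2 + a.im ^ 2) * b.re - (b.re ^ 2 + b.im ^ 2) * a.re) / (2 * a.im * b.im) * h10

theorem TriangleRel.eq_or_triDet_neg {a b c : ℍ} {p q r : ℝ} (h : TriangleRel a b c p q r)
    (hp : 0 < Real.sin p) (hq : 0 < Real.sin q) (hr : 0 < Real.sin r) :
    (a = b ∧ b = c) ∨ triDet a b c < 0 := by
  by_cases hab : a = b
  · left
    refine ⟨hab, ?_⟩
    have h1 := h.rotate.det
    have h2 : triDet b c a = 0 := by subst hab; simp [triDet]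
    rw [h2, mul_zero, neg_zero] at h1
    have h3 : coshDist b c ^ 2 - 1 = 0 := by
      rcases mul_eq_zero.1 h1 with h | h
      · exact absurd h (mul_pos hq hr).ne'
      · exact h
    have h4 := one_le_coshDist b c
    exact coshDist_eq_one_iff.1 (by nlinarith)
  · right
    have h1 := h.det
    have h2 := one_lt_coshDist hab
    have h3 : 0 < Real.sin p * Real.sin q * (coshDist a b ^ 2 - 1) :=
      mul_pos (mul_pos hp hq) (by nlinarith)
    rw [h1] at h3
    by_contra! h4
    have := mul_nonneg hr.le h4
    linarith

theorem TriangleRel.interiorAngle_eq {a b c : ℍ} {p q r : ℝ} (h : TriangleRel a b c p q r)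
    (hp : p ∈ Set.Ioo 0 Real.pi) (hq : q ∈ Set.Ioo 0 Real.pi) (hr : r ∈ Set.Ioo 0 Real.pi)
    (hD : triDet a b c < 0) : interiorAngle a b c = p := by
  have hp' := Real.sin_pos_of_mem_Ioo hp
  have hq' := Real.sin_pos_of_mem_Ioo hq
  have hr' := Real.sin_pos_of_mem_Ioo hr
  have h1 := h.cosh
  have h2 := h.rotate.cosh
  have h3 := h.rotate.rotate.cosh
  have h4 := h.det
  rw [coshDist_comm c a] at h3
  have hsc := Real.sin_sq_add_cos_sq p
  refine DeroinTholozan.interiorAngle_eq (κ := -triDet a b c / Real.sin p) ⟨hp.1.le, hp.2.le⟩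
    (div_pos (neg_pos.2 hD) hp') ?_ ?_
  · have hsq := Real.sin_sq_add_cos_sq q
    -- The three laws of cosines give all the distances in terms of the angles; the positive factor
    -- `sin p ^ 2 sin q sin r` clears the denominators.
    have h5 : (Real.sin p ^ 2 * Real.sin q * Real.sin r) *
        (coshDist a b * coshDist a c - coshDist b c) =
        (Real.sin p ^ 2 * Real.sin q * Real.sin r) *
          (-triDet a b c / Real.sin p * Real.cos p) := by
      have h6 : (Real.sin p ^ 2 * Real.sin q * Real.sin r) *
          (-triDet a b c / Real.sin p * Real.cos p) =
          Real.cos p * (Real.sin p * Real.sin q) * -(Real.sin r * triDet a b c) := by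
        field_simp
      rw [h6]
      linear_combination (Real.sin r * Real.sin p * coshDist a c) * h1
        + (Real.cos p * Real.cos q + Real.cos r) * h3 - Real.sin p ^ 2 * h2
        + Real.cos p * (Real.sin p * Real.sin q) * h4
        - Real.cos p * (Real.sin p * Real.sin q * coshDist a b + Real.cos p * Real.cos q
          + Real.cos r) * h1
        - (Real.cos q * Real.cos r + Real.cos p) * hsc
        + Real.cos p * (Real.sin q ^ 2 * hsc + (1 - Real.cos p ^ 2) * hsq)
    exact mul_left_cancel₀ (by positivity) h5
  · rw [abs_of_neg hD]; field_simp

/-- The relation between the rotations at the vertices of a triangle, cleared of denominators: up to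
positive factors the three matrices are `rotMat` at `∓` the interior angles. -/
theorem complexStr_gram_identity (a b c : ℍ) :
    ((coshDist a b * coshDist a c - coshDist b c) • 1 + triDet a b c • complexStr a) *
      ((coshDist b c * coshDist b a - coshDist c a) • 1 + triDet a b c • complexStr b) =
    -((coshDist a b ^ 2 - 1) • ((coshDist c a * coshDist c b - coshDist a b) • 1
      - triDet a b c • complexStr c)) := by
  have ha := a.im_ne_zero
  have hb := b.im_ne_zero
  have hc := c.im_ne_zero
  ext i j
  fin_cases i <;> fin_cases j <;>
  · simp [complexStr, Matrix.mul_apply, Fin.sum_univ_two, triDet, coshDist]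
    field_simp
    ring

/-- The rotations around the vertices of a clockwise triangle, by twice the interior angles, compose
to the identity of `PSL(2, ℝ)`, and to `-1` in `SL(2, ℝ)`. -/
theorem triangleRel_interiorAngle {a b c : ℍ} (hD : triDet a b c < 0) :
    TriangleRel a b c (interiorAngle a b c) (interiorAngle b c a) (interiorAngle c a b) := by
  have hab : a ≠ b := ne_of_triDet_ne_zero hD.ne
  have hbc : b ≠ c := ne_of_triDet_ne_zero (by rw [triDet_rotate]; exact hD.ne)
  have hca : c ≠ a := ne_of_triDet_ne_zero (by rw [triDet_rotate, triDet_rotate]; exact hD.ne)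
  have h1 := sinhDist_pos hab
  have h2 := sinhDist_pos hbc
  have h3 := sinhDist_pos hca
  have hs := sinhDist_sq a b
  have ca := cos_interiorAngle a b c
  have cb := cos_interiorAngle b c a
  have cc := cos_interiorAngle c a b
  have sa := sin_interiorAngle a b c
  have sb := sin_interiorAngle b c a
  have sc := sin_interiorAngle c a b
  rw [triDet_rotate, abs_of_neg hD] at sb
  rw [← triDet_rotate, abs_of_neg (by rwa [triDet_rotate])] at sa
  rw [triDet_rotate] at sa
  rw [triDet_rotate, triDet_rotate, abs_of_neg hD] at sc
  rw [sinhDist_comm a c] at ca sa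
  rw [sinhDist_comm b a] at cb sb
  rw [sinhDist_comm c b] at cc sc
  have key := complexStr_gram_identity a b c
  rw [← ca, ← cb, ← cc, ← hs] at key
  rw [triangleRel_iff]
  have hpos : sinhDist a b * sinhDist c a * (sinhDist b c * sinhDist a b) ≠ 0 := by positivity
  refine smul_right_injective _ hpos ?_
  have e1 : ∀ (z : ℍ) (t k u : ℝ), Real.cos t * k = u → Real.sin t * k = -triDet a b c →
      k • rotMat z (-t) = u • 1 + triDet a b c • complexStr z := by
    intro z t k u h h'
    rw [rotMat, smul_add, smul_smul, smul_smul, Real.cos_neg, Real.sin_neg, mul_comm k, h,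
      mul_neg, mul_comm k, h', neg_neg]
  have e3 : (sinhDist c a * sinhDist b c) • rotMat c (interiorAngle c a b) =
      (Real.cos (interiorAngle c a b) * (sinhDist c a * sinhDist b c)) • 1
        - triDet a b c • complexStr c := by
    rw [rotMat, smul_add, smul_smul, smul_smul, mul_comm (Real.cos _), mul_comm _ (Real.sin _), sc,
      neg_smul, sub_eq_add_neg]
  rw [← e1 a _ _ _ rfl sa, ← e1 b _ _ _ rfl sb, ← e3, smul_mul_smul_comm] at key
  change (sinhDist a b * sinhDist c a * (sinhDist b c * sinhDist a b)) • _ =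
    (sinhDist a b * sinhDist c a * (sinhDist b c * sinhDist a b)) • _
  rw [key, smul_smul, smul_neg, ← smul_neg, ← smul_neg]
  congr 1
  ring

theorem TriangleRel.neg_cos_add_lt {a b c : ℍ} {p q r : ℝ} (h : TriangleRel a b c p q r)
    (hab : a ≠ b) (hp : p ∈ Set.Ioo 0 Real.pi) (hq : q ∈ Set.Ioo 0 Real.pi) :
    -Real.cos (p + q) < Real.cos r := by
  have h1 := h.cosh
  have hp' := Real.sin_pos_of_mem_Ioo hp
  have hq' := Real.sin_pos_of_mem_Ioo hq
  have h2 := one_lt_coshDist hab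
  rw [Real.cos_add]
  nlinarith [mul_pos hp' hq']

theorem add_lt_of_neg_cos_lt {p q r : ℝ} (hp : p ∈ Set.Ioo 0 Real.pi) (hq : q ∈ Set.Ioo 0 Real.pi)
    (hr : r ∈ Set.Ioo 0 Real.pi) (h : -Real.cos (p + q) < Real.cos r) :
    p + q + r < Real.pi ∨ Real.pi + r < p + q := by
  by_contra! h'
  obtain ⟨h1, h2⟩ := h'
  obtain ⟨hp0, hp1⟩ := hp
  obtain ⟨hq0, hq1⟩ := hq
  obtain ⟨hr0, hr1⟩ := hr
  have h4 : Real.cos (p + q) + Real.cos r =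
      2 * Real.cos ((p + q + r) / 2) * Real.cos ((p + q - r) / 2) := by
    rw [Real.cos_add_cos]
  have h5 : Real.cos ((p + q + r) / 2) ≤ 0 :=
    Real.cos_nonpos_of_pi_div_two_le_of_le (by linarith) (by linarith)
  have h6 : 0 ≤ Real.cos ((p + q - r) / 2) :=
    Real.cos_nonneg_of_neg_pi_div_two_le_of_le (by linarith) (by linarith)
  nlinarith [mul_nonneg (neg_nonneg.2 h5) h6]

theorem TriangleRel.angle_sum_lt {a b c : ℍ} {p q r : ℝ} (h : TriangleRel a b c p q r)
    (hp : p ∈ Set.Ioo 0 Real.pi) (hq : q ∈ Set.Ioo 0 Real.pi) (hr : r ∈ Set.Ioo 0 Real.pi)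
    (hD : triDet a b c < 0) : p + q + r < Real.pi := by
  have hab : a ≠ b := ne_of_triDet_ne_zero hD.ne
  have hbc : b ≠ c := ne_of_triDet_ne_zero (by rw [triDet_rotate]; exact hD.ne)
  have h1 := add_lt_of_neg_cos_lt hp hq hr (h.neg_cos_add_lt hab hp hq)
  have h2 := add_lt_of_neg_cos_lt hq hr hp (h.rotate.neg_cos_add_lt hbc hq hr)
  -- If the angle sum were at least `π`, both `p + q > π + r` and `q + r > π + p` would hold, whence
  -- `q > π`.
  rcases h1 with h1 | h1
  · exact h1
  · rcases h2 with h2 | h2 <;> linarith [hq.1, hq.2]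

/-! ### The signed area as a sum over the sides -/

/-- Half the integral of `-dx / y` along the geodesic from `a` to `b`. As `dx / y` is a primitive of
`dx dy / y ^ 2`, the signed area of a triangle is a sum of such terms over its sides. -/
noncomputable def arcPrimitive (a b : ℍ) : ℝ := Real.arctan ((a.re - b.re) / (a.im + b.im))

/-- The signed area of the geodesic triangle `a b c`, positive for clockwise triangles, as a sum
over the sides (see `signedArea_eq`). -/
noncomputable def areaForm (a b c : ℍ) : ℝ :=
  2 * (arcPrimitive a b + arcPrimitive b c + arcPrimitive c a)

/-- Polar form of a complex number with positive real part. -/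
theorem exp_arctan_mul_I (x y : ℝ) (hx : 0 < x) :
    ∃ k : ℝ, 0 < k ∧
      Complex.exp ((Real.arctan (y / x) : ℝ) * Complex.I) * k = x + y * Complex.I := by
  refine ⟨x * √(1 + (y / x) ^ 2), by positivity, ?_⟩
  have h : √(1 + (y / x) ^ 2) ≠ 0 := by positivity
  rw [Complex.exp_mul_I, ← Complex.ofReal_cos, ← Complex.ofReal_sin, Real.cos_arctan,
    Real.sin_arctan]
  have hx' := hx.ne'
  have e1 : (1 / √(1 + (y / x) ^ 2)) * (x * √(1 + (y / x) ^ 2)) = x := by field_simp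
  have e2 : (y / x / √(1 + (y / x) ^ 2)) * (x * √(1 + (y / x) ^ 2)) = y := by field_simp
  rw [add_mul, mul_right_comm, ← Complex.ofReal_mul, ← Complex.ofReal_mul, e1, e2]

theorem exp_eq_of_mul_eq {s t k l : ℝ} (hk : 0 < k) (hl : 0 < l)
    (h : Complex.exp (s * Complex.I) * k = Complex.exp (t * Complex.I) * l) :
    Complex.exp (s * Complex.I) = Complex.exp (t * Complex.I) := by
  have h1 := congrArg (‖·‖) h
  simp only [norm_mul, Complex.norm_exp_ofReal_mul_I, Complex.norm_real, one_mul,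
    Real.norm_of_nonneg hk.le, Real.norm_of_nonneg hl.le] at h1
  rw [h1] at h
  exact mul_right_cancel₀ (by exact_mod_cast hl.ne') h

theorem eq_of_exp_eq {s t : ℝ} (h : Complex.exp (s * Complex.I) = Complex.exp (t * Complex.I))
    (h1 : s - t < 2 * Real.pi) (h2 : -(2 * Real.pi) < s - t) : s = t := by
  have h3 : Real.cos (s - t) = 1 := by
    have : Complex.exp ((s - t : ℝ) * Complex.I) = 1 := by
      rw [Complex.ofReal_sub, sub_mul, Complex.exp_sub, h, div_self (Complex.exp_ne_zero _)]
    rw [← Complex.exp_ofReal_mul_I_re, this, Complex.one_re]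
  have := (Real.cos_eq_one_iff_of_lt_of_lt h2 h1).1 h3
  linarith

theorem coshSum_pos (a b c : ℍ) : 0 < 1 + coshDist a b + coshDist b c + coshDist c a := by
  have := one_le_coshDist a b
  have := one_le_coshDist b c
  have := one_le_coshDist c a
  positivity

/-- The sum over the sides in terms of the invariants of the triangle. The arguments of the three
factors lie in `(-π/2, π/2)` and their product has positive real part, so no multiple of `2π`
arises. -/
theorem areaForm_eq (a b c : ℍ) : areaForm a b c =
    2 * Real.arctan (-triDet a b c / (1 + coshDist a b + coshDist b c + coshDist c a)) := by
  have ha := a.im_pos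
  have hb := b.im_pos
  have hc := c.im_pos
  obtain ⟨k1, hk1, h1⟩ := exp_arctan_mul_I (a.im + b.im) (a.re - b.re) (by positivity)
  obtain ⟨k2, hk2, h2⟩ := exp_arctan_mul_I (b.im + c.im) (b.re - c.re) (by positivity)
  obtain ⟨k3, hk3, h3⟩ := exp_arctan_mul_I (c.im + a.im) (c.re - a.re) (by positivity)
  obtain ⟨k4, hk4, h4⟩ := exp_arctan_mul_I _ (-triDet a b c) (coshSum_pos a b c)
  have hrange : ∀ x y : ℍ, -(Real.pi / 2) < arcPrimitive x y ∧ arcPrimitive x y < Real.pi / 2 :=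
    fun x y => ⟨Real.neg_pi_div_two_lt_arctan _, Real.arctan_lt_pi_div_two _⟩
  have r1 := hrange a b
  have r2 := hrange b c
  have r3 := hrange c a
  have r4 := Real.neg_pi_div_two_lt_arctan
    (-triDet a b c / (1 + coshDist a b + coshDist b c + coshDist c a))
  have r5 := Real.arctan_lt_pi_div_two
    (-triDet a b c / (1 + coshDist a b + coshDist b c + coshDist c a))
  rw [areaForm]
  congr 1
  refine eq_of_exp_eq (exp_eq_of_mul_eq (k := k1 * k2 * k3) (l := 2 * a.im * b.im * c.im * k4)
    (by positivity) (by positivity) ?_) (by linarith) (by linarith)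
  rw [← arcPrimitive] at h1 h2 h3
  have e1 : Complex.exp ((arcPrimitive a b + arcPrimitive b c + arcPrimitive c a : ℝ) * Complex.I)
      * (k1 * k2 * k3 : ℝ) = (Complex.exp (arcPrimitive a b * Complex.I) * k1) *
        (Complex.exp (arcPrimitive b c * Complex.I) * k2) *
        (Complex.exp (arcPrimitive c a * Complex.I) * k3) := by
    push_cast
    rw [add_mul, add_mul, Complex.exp_add, Complex.exp_add]
    ring
  rw [e1, h1, h2, h3, Complex.ofReal_mul, mul_left_comm, h4]
  apply Complex.ext
  all_goals
    simp only [Complex.mul_re, Complex.mul_im, Complex.add_re,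
      Complex.add_im, Complex.ofReal_re, Complex.ofReal_im,
      Complex.I_re, Complex.I_im, coshDist, triDet]
    field_simp
    ring

/-! ### The Gauss-Bonnet formula -/

/-- The trigonometric identity behind the Gauss-Bonnet formula: the factors on the left are positive
multiples of `exp (i p)`, `exp (i q)`, `exp (i r)` for the interior angles, and of `exp (i S)` for
the area, and the product is real. -/
theorem gram_product (x y z d : ℝ) (hd : d ^ 2 = 1 + 2 * x * y * z - x ^ 2 - y ^ 2 - z ^ 2) :
    (((x * z - y : ℝ) : ℂ) - d * Complex.I) * (((y * x - z : ℝ) : ℂ) - d * Complex.I) *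
      (((z * y - x : ℝ) : ℂ) - d * Complex.I) * ((1 + x + y + z : ℝ) + (-d : ℝ) * Complex.I) ^ 2 =
    ((-((x - 1) * (y - 1) * (z - 1) / 2 * ((1 + x + y + z) ^ 2 + d ^ 2) ^ 2) : ℝ) : ℂ) := by
  have key : (((x * z - y : ℝ) : ℂ) - d * Complex.I) * (((y * x - z : ℝ) : ℂ) - d * Complex.I) *
      (((z * y - x : ℝ) : ℂ) - d * Complex.I) =
      ((-((x - 1) * (y - 1) * (z - 1) / 2) : ℝ) : ℂ) *
        ((1 + x + y + z : ℝ) + d * Complex.I) ^ 2 := by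
    rw [pow_two]
    apply Complex.ext
    · simp only [Complex.mul_re, Complex.mul_im, Complex.add_re, Complex.sub_re, Complex.sub_im,
        Complex.add_im, Complex.ofReal_re, Complex.ofReal_im, Complex.I_re, Complex.I_im]
      linear_combination (-(x * z - y + y * x - z + z * y - x)
        - (x - 1) * (y - 1) * (z - 1) / 2) * hd
    · simp only [Complex.mul_re, Complex.mul_im, Complex.add_re, Complex.sub_re, Complex.sub_im,
        Complex.add_im, Complex.ofReal_re, Complex.ofReal_im, Complex.I_re, Complex.I_im]
      linear_combination d * hd
  rw [key]
  have e : ((1 + x + y + z : ℝ) + d * Complex.I) * ((1 + x + y + z : ℝ) + (-d : ℝ) * Complex.I) =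
      (((1 + x + y + z) ^ 2 + d ^ 2 : ℝ) : ℂ) := by
    push_cast
    linear_combination (-(d : ℂ) ^ 2) * Complex.I_sq
  rw [mul_assoc, ← mul_pow, e]
  push_cast
  ring

theorem triDet_rotate' (a b c : ℍ) : triDet c a b = triDet a b c := by
  rw [triDet_rotate, triDet_rotate]

theorem interiorAngle_mem_Ioo {a b c : ℍ} (hD : triDet a b c ≠ 0) :
    interiorAngle a b c ∈ Set.Ioo 0 Real.pi := by
  have hab : a ≠ b := ne_of_triDet_ne_zero hD
  have hca : c ≠ a := ne_of_triDet_ne_zero (by rwa [triDet_rotate'])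
  have h := sin_interiorAngle a b c
  have hs : 0 < Real.sin (interiorAngle a b c) := by
    have h1 : 0 < sinhDist a b * sinhDist a c := mul_pos (sinhDist_pos hab) (sinhDist_pos hca.symm)
    have h2 : 0 < |triDet a b c| := abs_pos.2 hD
    by_contra! h'
    nlinarith
  have hm := interiorAngle_mem a b c
  refine ⟨lt_of_le_of_ne hm.1 ?_, lt_of_le_of_ne hm.2 ?_⟩
  · intro h; rw [← h, Real.sin_zero] at hs; exact lt_irrefl _ hs
  · intro h; rw [h, Real.sin_pi] at hs; exact lt_irrefl _ hs

theorem areaForm_mem_Ioo {a b c : ℍ} (hD : triDet a b c < 0) :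
    areaForm a b c ∈ Set.Ioo 0 Real.pi := by
  have hτ := div_pos (neg_pos.2 hD) (coshSum_pos a b c)
  rw [areaForm_eq]
  refine ⟨?_, ?_⟩
  · have := Real.arctan_pos.2 hτ; positivity
  · have := Real.arctan_lt_pi_div_two
      (-triDet a b c / (1 + coshDist a b + coshDist b c + coshDist c a)); linarith

/-- The Gauss-Bonnet formula for a clockwise triangle. -/
theorem areaForm_eq_pi_sub_of_triDet_neg {a b c : ℍ} (hD : triDet a b c < 0) :
    areaForm a b c = Real.pi - interiorAngle a b c - interiorAngle b c a - interiorAngle c a b := by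
  have hrel := triangleRel_interiorAngle hD
  have hD2 : triDet b c a < 0 := by rwa [triDet_rotate]
  have hD3 : triDet c a b < 0 := by rwa [triDet_rotate']
  have h1 := sinhDist_pos (ne_of_triDet_ne_zero hD.ne)
  have h2 := sinhDist_pos (ne_of_triDet_ne_zero hD2.ne)
  have h3 := sinhDist_pos (ne_of_triDet_ne_zero hD3.ne)
  have ca := cos_interiorAngle a b c
  have cb := cos_interiorAngle b c a
  have cc := cos_interiorAngle c a b
  have sa := sin_interiorAngle a b c
  have sb := sin_interiorAngle b c a
  have sc := sin_interiorAngle c a b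
  rw [triDet_rotate, abs_of_neg hD, sinhDist_comm b a] at sb
  rw [abs_of_neg hD, sinhDist_comm a c] at sa
  rw [triDet_rotate', abs_of_neg hD, sinhDist_comm c b] at sc
  have pa := interiorAngle_mem_Ioo hD.ne
  have pb := interiorAngle_mem_Ioo hD2.ne
  have pc := interiorAngle_mem_Ioo hD3.ne
  have hlt := hrel.angle_sum_lt pa pb pc hD
  have hS := areaForm_eq a b c
  obtain ⟨hS0, hS1⟩ := areaForm_mem_Ioo hD
  set p := interiorAngle a b c
  set q := interiorAngle b c a
  set r := interiorAngle c a b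
  obtain ⟨k4, hk4, h4⟩ := exp_arctan_mul_I _ (-triDet a b c) (coshSum_pos a b c)
  have hg := gram_product (coshDist a b) (coshDist b c) (coshDist c a) (triDet a b c)
    (triDet_sq a b c)
  have hexp : ∀ {t k u : ℝ}, Real.cos t * k = u → Real.sin t * k = -triDet a b c →
      (u : ℂ) - triDet a b c * Complex.I = Complex.exp (t * Complex.I) * k := by
    intro t k u h h'
    rw [Complex.exp_mul_I, ← Complex.ofReal_cos, ← Complex.ofReal_sin, add_mul, mul_right_comm,
      ← Complex.ofReal_mul, ← Complex.ofReal_mul, h, h']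
    push_cast; ring
  rw [coshDist_comm a c, sinhDist_comm a c] at ca
  rw [coshDist_comm b a, sinhDist_comm b a] at cb
  rw [coshDist_comm c b, sinhDist_comm c b] at cc
  rw [hexp ca sa, hexp cb sb, hexp cc sc, ← h4] at hg
  set T := Real.arctan (-triDet a b c / (1 + coshDist a b + coshDist b c + coshDist c a))
  obtain ⟨X, hg⟩ : ∃ X : ℝ, _ = (X : ℂ) := ⟨_, hg⟩
  have h5 : Complex.exp ((p + q + r + areaForm a b c : ℝ) * Complex.I) *
      ((sinhDist a b * sinhDist c a) * (sinhDist b c * sinhDist a b) *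
        (sinhDist c a * sinhDist b c) * k4 ^ 2 : ℝ) = X := by
    rw [← hg, hS]
    push_cast
    rw [add_mul, add_mul, add_mul, Complex.exp_add, Complex.exp_add, Complex.exp_add, two_mul,
      add_mul, Complex.exp_add]
    ring
  have h6 := congrArg Complex.im h5
  rw [Complex.im_mul_ofReal, Complex.exp_ofReal_mul_I_im, Complex.ofReal_im] at h6
  have h7 : Real.sin (p + q + r + areaForm a b c) = 0 :=
    (mul_eq_zero.1 h6).resolve_right (by positivity)
  have h8 : Real.sin (p + q + r + areaForm a b c - Real.pi) = 0 := by
    rw [Real.sin_sub_pi, h7, neg_zero]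
  -- The argument lies in `(-π, π)`, because `0 < p + q + r < π` and `0 < areaForm a b c < π`.
  have h9 := (Real.sin_eq_zero_iff_of_lt_of_lt (by linarith [pa.1, pb.1, pc.1]) (by linarith)).1 h8
  linarith

theorem cos_eq_neg_one_of_rotMat_eq {z : ℍ} {t : ℝ} (h : rotMat z t = -1) : Real.cos t = -1 := by
  have hs : Real.sin t = 0 := by
    have := congrFun (congrFun h 1) 0
    simpa [rotMat, complexStr, z.im_ne_zero] using this
  have := congrFun (congrFun h 0) 0
  simpa [rotMat, hs] using this

/-- The Gauss-Bonnet formula, including triangles reduced to a point, which have angle sum `π`. -/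
theorem TriangleRel.areaForm_eq {a b c : ℍ} {p q r : ℝ} (h : TriangleRel a b c p q r)
    (hp : p ∈ Set.Ioo 0 Real.pi) (hq : q ∈ Set.Ioo 0 Real.pi) (hr : r ∈ Set.Ioo 0 Real.pi) :
    areaForm a b c = Real.pi - p - q - r := by
  rcases h.eq_or_triDet_neg (Real.sin_pos_of_mem_Ioo hp) (Real.sin_pos_of_mem_Ioo hq)
    (Real.sin_pos_of_mem_Ioo hr) with ⟨rfl, rfl⟩ | hD
  · rw [TriangleRel, rotMat_mul, rotMat_mul] at h
    have h1 := cos_eq_neg_one_of_rotMat_eq h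
    have h2 : Real.cos (p + q + r - Real.pi) = 1 := by
      rw [Real.cos_sub_pi, ← Real.cos_neg, ← neg_neg (1 : ℝ), ← h1]; ring_nf
    have h3 := (Real.cos_eq_one_iff_of_lt_of_lt
      (by linarith [hp.1, hq.1, hr.1, Real.pi_pos]) (by linarith [hp.2, hq.2, hr.2])).1 h2
    have h4 : areaForm a a a = 0 := by simp [areaForm, arcPrimitive]
    rw [h4]; linarith
  · rw [areaForm_eq_pi_sub_of_triDet_neg hD, h.interiorAngle_eq hp hq hr hD,
      h.rotate.interiorAngle_eq hq hr hp (by rwa [triDet_rotate]),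
      h.rotate.rotate.interiorAngle_eq hr hp hq (by rwa [triDet_rotate'])]

theorem arcPrimitive_swap (a b : ℍ) : arcPrimitive b a = -arcPrimitive a b := by
  rw [arcPrimitive, arcPrimitive, ← Real.arctan_neg]
  congr 1
  rw [add_comm, ← neg_div]; ring

theorem areaForm_rotate (a b c : ℍ) : areaForm b c a = areaForm a b c := by
  simp only [areaForm]; ring

theorem areaForm_swap (a b c : ℍ) : areaForm b a c = -areaForm a b c := by
  simp only [areaForm, arcPrimitive_swap b a, arcPrimitive_swap c a, arcPrimitive_swap b c]; ring

theorem abs_areaForm_le (a b c : ℍ) : |areaForm a b c| ≤ Real.pi := by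
  rw [areaForm_eq, abs_mul, abs_two]
  have := abs_le.2 ⟨(Real.neg_pi_div_two_lt_arctan
      (-triDet a b c / (1 + coshDist a b + coshDist b c + coshDist c a))).le,
    (Real.arctan_lt_pi_div_two
      (-triDet a b c / (1 + coshDist a b + coshDist b c + coshDist c a))).le⟩
  linarith

/-! ### Invariance under isometries -/

theorem triDet_eq_trace (a b c : ℍ) :
    triDet a b c = (complexStr a * complexStr b * complexStr c).trace / 2 := by
  have ha := a.im_ne_zero
  have hb := b.im_ne_zero
  have hc := c.im_ne_zero
  simp [complexStr, Matrix.trace_fin_two, triDet]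
  field_simp
  ring

/-- The map `z ↦ J_z` intertwines the Möbius action with conjugation. -/
theorem complexStr_smul (g : SL(2, ℝ)) (z : ℍ) :
    complexStr (g • z) * g.1 = g.1 * complexStr z := by
  have hz := z.im_pos
  have hdet := g.det_coe
  rw [Matrix.det_fin_two] at hdet
  set a := g.1 0 0 with ha
  set b := g.1 0 1 with hb
  set c := g.1 1 0 with hc
  set d := g.1 1 1 with hd
  have hcoe := UpperHalfPlane.coe_specialLinearGroup_apply g z
  have hn : (c * z.re + d) ^ 2 + (c * z.im) ^ 2 ≠ 0 := by
    intro h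
    have h1 : c * z.im = 0 := by nlinarith [sq_nonneg (c * z.re + d), sq_nonneg (c * z.im)]
    have h2 : c = 0 := (mul_eq_zero.1 h1).resolve_right hz.ne'
    have h3 : d = 0 := by
      rw [h2] at h; simpa using h
    rw [h2, h3] at hdet; simp at hdet
  have hden : (c : ℂ) * z + d ≠ 0 := by
    intro h
    apply hn
    have h1 := congrArg Complex.re h
    have h2 := congrArg Complex.im h
    simp at h1 h2
    rw [h1]
    rcases h2 with h2 | h2
    · rw [h2]; ring
    · rw [h2]; ring
  have hmul : ((g • z : ℍ) : ℂ) * ((c : ℂ) * z + d) = a * z + b := by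
    rw [hcoe]
    exact div_mul_cancel₀ _ hden
  have e1 := congrArg Complex.re hmul
  have e2 := congrArg Complex.im hmul
  simp only [Complex.mul_re, Complex.mul_im, Complex.add_re, Complex.add_im, Complex.ofReal_re,
    Complex.ofReal_im, UpperHalfPlane.coe_re, UpperHalfPlane.coe_im, zero_mul, sub_zero, add_zero]
    at e1 e2
  have hre : (g • z).re = ((a * z.re + b) * (c * z.re + d) + a * c * z.im ^ 2) /
      ((c * z.re + d) ^ 2 + (c * z.im) ^ 2) := by
    rw [eq_div_iff hn]
    linear_combination (c * z.re + d) * e1 + c * z.im * e2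
  have him : (g • z).im = z.im / ((c * z.re + d) ^ 2 + (c * z.im) ^ 2) := by
    rw [eq_div_iff hn]
    linear_combination (c * z.re + d) * e2 - c * z.im * e1 + z.im * hdet
  have hz' := hz.ne'
  have f1 : (g • z).re / (g • z).im =
      ((a * z.re + b) * (c * z.re + d) + a * c * z.im ^ 2) / z.im := by
    rw [hre, him, div_div_div_cancel_right₀ hn]
  have f2 : 1 / (g • z).im = ((c * z.re + d) ^ 2 + (c * z.im) ^ 2) / z.im := by
    rw [him, one_div_div]
  have f3 : ((g • z).re ^ 2 + (g • z).im ^ 2) / (g • z).im =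
      ((a * z.re + b) ^ 2 + a ^ 2 * z.im ^ 2) / z.im := by
    have : (g • z).re ^ 2 + (g • z).im ^ 2 = ((a * z.re + b) ^ 2 + a ^ 2 * z.im ^ 2) /
        ((c * z.re + d) ^ 2 + (c * z.im) ^ 2) := by
      rw [eq_div_iff hn]
      linear_combination ((g • z).re * (c * z.re + d) - (g • z).im * (c * z.im)
        + (a * z.re + b)) * e1 + ((g • z).re * (c * z.im) + (g • z).im * (c * z.re + d)
        + a * z.im) * e2
    rw [this, him, div_div_div_cancel_right₀ hn]
  have e : ∀ M N : Matrix (Fin 2) (Fin 2) ℝ, M 0 0 = N 0 0 → M 0 1 = N 0 1 → M 1 0 = N 1 0 →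
      M 1 1 = N 1 1 → M = N := by
    intro M N h1 h2 h3 h4
    ext i j; fin_cases i <;> fin_cases j <;> assumption
  have hg : g.1 = !![a, b; c, d] := e _ _ rfl rfl rfl rfl
  rw [hg, complexStr, complexStr, f1, f2, f3]
  clear_value a b c d
  apply e
  · simp
    field_simp
    linear_combination (-(a * z.re + b)) * hdet
  · simp
    field_simp
    linear_combination ((a * z.re + b) * z.re + a * z.im ^ 2) * hdet
  · simp
    field_simp
    linear_combination (-(c * z.re + d)) * hdet
  · simp
    field_simp
    linear_combination ((c * z.re + d) * z.re + c * z.im ^ 2) * hdet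

theorem complexStr_smul' (g : SL(2, ℝ)) (z : ℍ) :
    complexStr (g • z) = g.1 * complexStr z * (g⁻¹).1 := by
  rw [← complexStr_smul, mul_assoc, ← Matrix.SpecialLinearGroup.coe_mul, mul_inv_cancel,
    Matrix.SpecialLinearGroup.coe_one, mul_one]

theorem triDet_smul (g : SL(2, ℝ)) (a b c : ℍ) :
    triDet (g • a) (g • b) (g • c) = triDet a b c := by
  have h : (g⁻¹).1 * g.1 = 1 := by
    rw [← Matrix.SpecialLinearGroup.coe_mul, inv_mul_cancel, Matrix.SpecialLinearGroup.coe_one]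
  rw [triDet_eq_trace, triDet_eq_trace, complexStr_smul', complexStr_smul', complexStr_smul']
  have e : g.1 * complexStr a * (g⁻¹).1 * (g.1 * complexStr b * (g⁻¹).1) *
      (g.1 * complexStr c * (g⁻¹).1) = g.1 * (complexStr a * complexStr b * complexStr c *
        (g⁻¹).1) := by
    calc _ = g.1 * complexStr a * ((g⁻¹).1 * g.1) * complexStr b * ((g⁻¹).1 * g.1) *
        complexStr c * (g⁻¹).1 := by simp only [mul_assoc]
      _ = _ := by rw [h]; simp only [mul_assoc, mul_one]
  rw [e, Matrix.trace_mul_comm, mul_assoc, h, mul_one]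

theorem coshDist_smul (g : SL(2, ℝ)) (a b : ℍ) : coshDist (g • a) (g • b) = coshDist a b := by
  rw [coshDist_eq, coshDist_eq, dist_smul]

theorem areaForm_smul (A : G) (a b c : ℍ) :
    areaForm (A • a) (A • b) (A • c) = areaForm a b c := by
  obtain ⟨g, rfl⟩ := QuotientGroup.mk_surjective A
  rw [mk_smul, mk_smul, mk_smul, areaForm_eq, areaForm_eq, triDet_smul, coshDist_smul,
    coshDist_smul, coshDist_smul]

theorem rotMat_smul (g : SL(2, ℝ)) (z : ℍ) (t : ℝ) :
    rotMat (g • z) t = g.1 * rotMat z t * (g⁻¹).1 := by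
  have h : g.1 * (g⁻¹).1 = 1 := by
    rw [← Matrix.SpecialLinearGroup.coe_mul, mul_inv_cancel, Matrix.SpecialLinearGroup.coe_one]
  rw [rotMat, rotMat, complexStr_smul', mul_add, add_mul, mul_smul_comm, mul_smul_comm,
    smul_mul_assoc, smul_mul_assoc, mul_one, h]

/-! ### Rotations in `PSL(2, ℝ)` -/

/-- The lift of the rotation of angle `2 t` around `z` to `SL(2, ℝ)`. -/
noncomputable def rotSL (z : ℍ) (t : ℝ) : SL(2, ℝ) := ⟨rotMat z t, det_rotMat z t⟩

/-- The anti-clockwise rotation of angle `θ` around `z`. -/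
noncomputable def rotAt (z : ℍ) (θ : ℝ) : G := (rotSL z (θ / 2) : SL(2, ℝ))

theorem rotSL_mul (z : ℍ) (s t : ℝ) : rotSL z s * rotSL z t = rotSL z (s + t) :=
  Subtype.ext (rotMat_mul z s t)

theorem rotSL_smul (g : SL(2, ℝ)) (z : ℍ) (t : ℝ) : rotSL (g • z) t = g * rotSL z t * g⁻¹ :=
  Subtype.ext (rotMat_smul g z t)

theorem rotAt_smul (A : G) (z : ℍ) (θ : ℝ) : rotAt (A • z) θ = A * rotAt z θ * A⁻¹ := by
  obtain ⟨g, rfl⟩ := QuotientGroup.mk_surjective A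
  rw [mk_smul, rotAt, rotSL_smul]
  rfl

theorem rotAt_neg (z : ℍ) (θ : ℝ) : rotAt z (-θ) = (rotAt z θ)⁻¹ := by
  rw [eq_inv_iff_mul_eq_one, rotAt, rotAt, ← QuotientGroup.mk_mul, rotSL_mul]
  have : rotSL z (-θ / 2 + θ / 2) = 1 := by
    apply Subtype.ext
    change rotMat z _ = 1
    rw [neg_div, neg_add_cancel, rotMat_zero]
  rw [this]; rfl

theorem complexStr_I : complexStr UpperHalfPlane.I = !![0, 1; -1, 0] := by
  simp [complexStr]

theorem rotAt_I (θ : ℝ) : rotAt UpperHalfPlane.I θ = rot θ := by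
  rw [rotAt, rot]
  congr 1
  apply Subtype.ext
  change rotMat _ _ = _
  ext i j
  fin_cases i <;> fin_cases j <;> simp [rotMat, complexStr_I]

theorem mk_eq_mk_iff {g h : SL(2, ℝ)} : (g : G) = (h : G) ↔ g.1 = h.1 ∨ g.1 = -h.1 := by
  rw [QuotientGroup.eq, Matrix.SpecialLinearGroup.mem_center_iff]
  constructor
  · rintro ⟨r, hr, h1⟩
    have h2 : g.1 * (Matrix.scalar (Fin 2) r) = h.1 := by
      rw [h1, ← Matrix.SpecialLinearGroup.coe_mul, mul_inv_cancel_left]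
    have hr' : r = 1 ∨ r = -1 := by
      rw [Fintype.card_fin] at hr; exact sq_eq_one_iff.1 hr
    rcases hr' with rfl | rfl
    · left; rw [← h2]; simp
    · right; rw [← h2, map_neg, map_one, mul_neg, mul_one, neg_neg]
  · rintro (h1 | h1)
    · refine ⟨1, by simp, ?_⟩
      rw [show g = h from Subtype.ext h1]; simp
    · refine ⟨-1, by simp, ?_⟩
      have : g = -h := Subtype.ext h1
      rw [this, map_neg, map_one, inv_neg, neg_mul, inv_mul_cancel]; rfl

theorem exists_smul_I (z : ℍ) : ∃ A : G, A • UpperHalfPlane.I = z :=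
  ⟨(z.toSL2R : SL(2, ℝ)), by rw [mk_smul, UpperHalfPlane.toSL2R_smul_I]⟩

/-! ### Elliptic elements are rotations -/

theorem smul_eq_self_iff {g : SL(2, ℝ)} {z : ℍ} :
    g • z = z ↔ complexStr z * g.1 = g.1 * complexStr z := by
  constructor
  · intro h
    rw [← complexStr_smul, h]
  · intro h
    apply complexStr_injective
    rw [complexStr_smul', ← h, mul_assoc, ← Matrix.SpecialLinearGroup.coe_mul, mul_inv_cancel,
      Matrix.SpecialLinearGroup.coe_one, mul_one]

theorem rotAt_smul_self (z : ℍ) (θ : ℝ) : rotAt z θ • z = z := by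
  rw [rotAt, mk_smul, smul_eq_self_iff]
  simp only [rotSL, rotMat, mul_add, add_mul, mul_smul_comm, smul_mul_assoc, mul_one, one_mul]

theorem eq_of_complexStr_commute {z w : ℍ}
    (h : complexStr z * complexStr w = complexStr w * complexStr z) : z = w := by
  have hz := z.im_pos
  have hw := w.im_pos
  have h00 := congrFun (congrFun h 0) 0
  have h10 := congrFun (congrFun h 1) 0
  simp [complexStr] at h00 h10
  field_simp at h00 h10
  have h1 : z.re = w.re := by linarith
  refine ext_of_re_im h1 ?_
  rw [h1] at h00
  nlinarith

theorem isElliptic_rotAt {z : ℍ} {θ : ℝ} (hθ : θ ∈ Set.Ioo 0 (2 * Real.pi)) :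
    IsElliptic (rotAt z θ) := by
  refine ⟨z, rotAt_smul_self z θ, ?_⟩
  intro w hw
  simp only [rotAt, mk_smul, smul_eq_self_iff] at hw
  simp only [rotSL, rotMat, mul_add, add_mul, mul_smul_comm, smul_mul_assoc, mul_one, one_mul,
    add_right_inj] at hw
  have hs : Real.sin (θ / 2) ≠ 0 :=
    (Real.sin_pos_of_pos_of_lt_pi (by linarith [hθ.1]) (by linarith [hθ.2])).ne'
  exact eq_of_complexStr_commute (smul_right_injective _ hs hw)

theorem hasAngle_rotAt {z : ℍ} {θ : ℝ} (hθ : θ ∈ Set.Ioo 0 (2 * Real.pi)) :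
    HasAngle (rotAt z θ) θ := by
  obtain ⟨A, rfl⟩ := exists_smul_I z
  refine ⟨hθ, isConj_iff.2 ⟨A, ?_⟩⟩
  rw [rotAt_smul, rotAt_I]

theorem isFixOf_rotAt {z : ℍ} {θ : ℝ} (hθ : θ ∈ Set.Ioo 0 (2 * Real.pi)) :
    IsFixOf z (rotAt z θ) := ⟨isElliptic_rotAt hθ, rotAt_smul_self z θ⟩

theorem eq_rotAt_of_hasAngle {A : G} {θ : ℝ} {z : ℍ} (h : HasAngle A θ) (hz : IsFixOf z A) :
    A = rotAt z θ := by
  obtain ⟨hθ, hc⟩ := h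
  obtain ⟨B, hB⟩ := isConj_iff.1 hc
  rw [← rotAt_I, ← rotAt_smul] at hB
  have h1 : B • UpperHalfPlane.I = z :=
    hz.1.unique (by rw [← hB]; exact rotAt_smul_self _ _) hz.2
  rw [← hB, h1]

theorem not_isElliptic_one : ¬ IsElliptic (1 : G) := by
  intro h
  have h1 := h.unique (one_smul G UpperHalfPlane.I)
    (one_smul G (⟨2 * Complex.I, by simp⟩ : ℍ))
  have := congrArg UpperHalfPlane.im h1
  simp [UpperHalfPlane.im] at this

theorem exists_eq_rotAt {A : G} {z : ℍ} (hz : IsFixOf z A) :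
    ∃ θ ∈ Set.Ioo 0 (2 * Real.pi), A = rotAt z θ := by
  obtain ⟨g, rfl⟩ := QuotientGroup.mk_surjective A
  have hy := z.im_ne_zero
  have hfix : g • z = z := hz.2
  rw [smul_eq_self_iff] at hfix
  have h00 := congrFun (congrFun hfix 0) 0
  have h10 := congrFun (congrFun hfix 1) 0
  simp [complexStr, Matrix.mul_apply, Fin.sum_univ_two] at h00 h10
  field_simp at h00 h10
  have hdet := g.det_coe
  rw [Matrix.det_fin_two] at hdet
  set κ := (g.1 0 0 + g.1 1 1) / 2 with hκ
  set s := -(g.1 1 0 * z.im) with hs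
  have hg : g.1 = κ • 1 + s • complexStr z := by
    ext i j
    fin_cases i <;> fin_cases j <;> simp [complexStr, hκ, hs] <;> field_simp <;> linarith
  have hone : κ ^ 2 + s ^ 2 = 1 := by
    rw [hκ, hs]
    have h01 : g.1 0 1 = - (g.1 1 0 * (z.re ^ 2 + z.im ^ 2)) := by linarith
    rw [h01] at hdet
    have h5 : g.1 0 0 = g.1 1 1 + 2 * z.re * g.1 1 0 := by linarith
    rw [h5] at hdet ⊢
    linear_combination hdet
  have hcase : ∀ κ' s' : ℝ, κ' ^ 2 + s' ^ 2 = 1 → 0 < s' →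
      ∃ θ ∈ Set.Ioo 0 (2 * Real.pi), κ' • (1 : Matrix (Fin 2) (Fin 2) ℝ) + s' • complexStr z =
        rotMat z (θ / 2) := by
    intro κ' s' h1 h2
    have h3 : -1 < κ' := by nlinarith
    have h4 : κ' < 1 := by nlinarith
    refine ⟨2 * Real.arccos κ', ⟨?_, ?_⟩, ?_⟩
    · have := Real.arccos_pos.2 h4; positivity
    · have := Real.arccos_lt_pi.2 h3; linarith
    · rw [mul_div_cancel_left₀ _ two_ne_zero, rotMat, Real.cos_arccos h3.le h4.le,
        Real.sin_arccos, show 1 - κ' ^ 2 = s' ^ 2 by linarith, Real.sqrt_sq h2.le]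
  rcases lt_trichotomy s 0 with h | h | h
  · obtain ⟨θ, hθ, h1⟩ := hcase (-κ) (-s) (by rw [neg_sq, neg_sq, hone]) (by linarith)
    refine ⟨θ, hθ, mk_eq_mk_iff.2 (Or.inr ?_)⟩
    change g.1 = -rotMat z (θ / 2)
    rw [← h1, hg]; module
  · exfalso
    apply not_isElliptic_one
    have : ((1 : SL(2, ℝ)) : G) = (g : G) := by
      rw [mk_eq_mk_iff, hg, h]
      rw [h] at hone
      have : κ = 1 ∨ κ = -1 := sq_eq_one_iff.1 (by linarith)
      rcases this with h | h
      · left; simp [h]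
      · right; simp [h]
    rw [← QuotientGroup.mk_one, this]
    exact hz.1
  · obtain ⟨θ, hθ, h1⟩ := hcase κ s hone h
    refine ⟨θ, hθ, mk_eq_mk_iff.2 (Or.inl ?_)⟩
    change g.1 = rotMat z (θ / 2)
    rw [← h1, hg]

/-! ### Products of two rotations -/

theorem rotAt_mul_eq_iff {a b c : ℍ} {s t u : ℝ} :
    rotAt a s * rotAt b t = rotAt c u ↔
      rotMat a (s / 2) * rotMat b (t / 2) = rotMat c (u / 2) ∨
        rotMat a (s / 2) * rotMat b (t / 2) = -rotMat c (u / 2) := by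
  rw [rotAt, rotAt, rotAt, ← QuotientGroup.mk_mul, mk_eq_mk_iff]
  rfl

theorem rotAt_mul_eq_of_triangleRel {a b c : ℍ} {β α β' : ℝ}
    (h : TriangleRel a b c (β / 2) (Real.pi - α / 2) (Real.pi - β' / 2)) :
    rotAt a (-β) * rotAt b α = rotAt c (-β') := by
  rw [rotAt_mul_eq_iff]
  right
  rw [triangleRel_iff, neg_sub, rotMat_sub_pi] at h
  have h1 : rotMat c (Real.pi - β' / 2) = -rotMat c (-β' / 2) := by
    rw [← rotMat_add_pi]; congr 1; ring
  rw [h1, mul_neg, neg_neg] at h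
  rw [neg_div, ← neg_neg (rotMat a _ * _), h, neg_div]

/-- The two signs of the lift to `SL(2, ℝ)` of an equation between rotations correspond to the two
orientations of the triangle of their centres. -/
theorem triangleRel_or_of_rotAt_mul_eq {a b c : ℍ} {β α β' : ℝ}
    (h : rotAt a (-β) * rotAt b α = rotAt c (-β')) :
    TriangleRel a b c (β / 2) (Real.pi - α / 2) (Real.pi - β' / 2) ∨
      TriangleRel b a c (α / 2) (Real.pi - β / 2) (β' / 2) := by
  rw [rotAt_mul_eq_iff] at h
  rcases h with h | h
  · right
    rw [triangleRel_iff, neg_sub, rotMat_sub_pi, mul_neg]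
    congr 1
    have e1 : rotMat b (-(α / 2)) * rotMat a (β / 2) *
        (rotMat a (-β / 2) * rotMat b (α / 2)) = 1 := by
      rw [mul_assoc, ← mul_assoc (rotMat a (β / 2)), neg_div, rotMat_mul_neg, one_mul,
        rotMat_neg_mul]
    rw [h] at e1
    calc _ = rotMat b (-(α / 2)) * rotMat a (β / 2) * (rotMat c (-β' / 2) * rotMat c (β' / 2)) := by
            rw [neg_div, rotMat_neg_mul, mul_one]
      _ = _ := by rw [← mul_assoc, e1, one_mul]
  · left
    rw [triangleRel_iff, neg_sub, rotMat_sub_pi]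
    have h1 : rotMat c (Real.pi - β' / 2) = -rotMat c (-β' / 2) := by
      rw [← rotMat_add_pi]; congr 1; ring
    rw [h1, mul_neg, neg_neg, ← neg_div, h, neg_neg]

theorem complexStr_mul_add_mul (a b : ℍ) :
    complexStr a * complexStr b + complexStr b * complexStr a = (-(2 * coshDist a b)) • 1 := by
  have ha := a.im_ne_zero
  have hb := b.im_ne_zero
  ext i j
  fin_cases i <;> fin_cases j <;>
  · simp [complexStr, coshDist]
    field_simp
    ring

theorem trace_complexStr (a : ℍ) : (complexStr a).trace = 0 := by
  simp [complexStr, Matrix.trace_fin_two]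

theorem trace_complexStr_mul (a b : ℍ) :
    (complexStr a * complexStr b).trace = -2 * coshDist a b := by
  have h := congrArg Matrix.trace (complexStr_mul_add_mul a b)
  rw [Matrix.trace_add, Matrix.trace_mul_comm (complexStr b), Matrix.trace_smul,
    Matrix.trace_one, Fintype.card_fin] at h
  simp at h
  linarith

theorem trace_rotMat (z : ℍ) (t : ℝ) : (rotMat z t).trace = 2 * Real.cos t := by
  simp [rotMat, Matrix.trace_add, trace_complexStr, Matrix.trace_smul, mul_comm]

theorem rotMat_mul_add_mul (a b : ℍ) (s t : ℝ) :
    rotMat a s * rotMat b t + rotMat b t * rotMat a s =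
      (rotMat a s * rotMat b t).trace • 1 + (2 * (Real.sin s * Real.cos t)) • complexStr a
        + (2 * (Real.cos s * Real.sin t)) • complexStr b := by
  have h1 : (rotMat a s * rotMat b t).trace =
      2 * (Real.cos s * Real.cos t) - 2 * (Real.sin s * Real.sin t * coshDist a b) := by
    simp only [rotMat, mul_add, add_mul, smul_mul_assoc, mul_smul_comm, mul_one, one_mul,
      Matrix.trace_add, Matrix.trace_smul, trace_complexStr, trace_complexStr_mul, Matrix.trace_one,
      Fintype.card_fin, smul_eq_mul]
    push_cast; ring
  have h2 : rotMat a s * rotMat b t + rotMat b t * rotMat a s =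
      (2 * (Real.cos s * Real.cos t)) • 1 + (Real.sin s * Real.sin t) •
        (complexStr a * complexStr b + complexStr b * complexStr a)
        + (2 * (Real.sin s * Real.cos t)) • complexStr a
        + (2 * (Real.cos s * Real.sin t)) • complexStr b := by
    simp only [rotMat, mul_add, add_mul, smul_mul_assoc, mul_smul_comm, mul_one, one_mul]
    module
  rw [h2, complexStr_mul_add_mul, h1]
  module

/-- If `P Q = ± R` for rotations `P`, `Q`, `R` around `a`, `b`, `c`, then `P b` is the mirror image
of `b` in the geodesic `a c`. By the relation, `J_c` and `P⁻¹ J_c P` are affine functions of `P Q`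
and `Q P`, and `P Q + Q P` is a combination of `1`, `J_a` and `J_b`. -/
theorem triDet_rotSL_smul {a b c : ℍ} {s t u σ : ℝ} (hu : Real.sin u ≠ 0) (hσ : σ ^ 2 = 1)
    (h : rotMat a s * rotMat b t = σ • rotMat c u) :
    triDet c a (rotSL a s • b) = -triDet c a b := by
  have hab := rotMat_mul_add_mul a b s t
  have hinv : ((rotSL a s)⁻¹).1 = rotMat a (-s) := by
    have : (rotSL a s)⁻¹ = rotSL a (-s) := by
      rw [inv_eq_iff_mul_eq_one, rotSL_mul, add_neg_cancel]
      exact Subtype.ext (rotMat_zero a)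
    rw [this]; rfl
  have hJc : Real.sin u • complexStr c = σ • (rotMat a s * rotMat b t) - Real.cos u • 1 := by
    rw [h, smul_smul, ← pow_two, hσ, one_smul, rotMat]; module
  have hconj : Real.sin u • (rotMat a (-s) * complexStr c * rotMat a s) =
      σ • (rotMat b t * rotMat a s) - Real.cos u • 1 := by
    rw [← smul_mul_assoc, ← mul_smul_comm, hJc, mul_sub, sub_mul, mul_smul_comm, smul_mul_assoc,
      mul_smul_comm, smul_mul_assoc, mul_one, rotMat_neg_mul, ← mul_assoc, rotMat_neg_mul, one_mul]
  have hcomm : complexStr a * rotMat a s = rotMat a s * complexStr a := by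
    simp only [rotMat, mul_add, add_mul, mul_smul_comm, smul_mul_assoc, mul_one, one_mul]
  have e1 : (complexStr c * complexStr a * complexStr (rotSL a s • b)).trace =
      (rotMat a (-s) * complexStr c * rotMat a s * (complexStr a * complexStr b)).trace := by
    rw [complexStr_smul', hinv]
    change (complexStr c * complexStr a * (rotMat a s * complexStr b * rotMat a (-s))).trace = _
    rw [← mul_assoc, Matrix.trace_mul_comm]
    congr 1
    rw [mul_assoc (complexStr c), ← mul_assoc (complexStr a), hcomm]
    simp only [mul_assoc]
  have e2 : (complexStr c * complexStr a * complexStr b).trace =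
      (complexStr c * (complexStr a * complexStr b)).trace := by rw [mul_assoc]
  have e3 : Real.sin u • (rotMat a (-s) * complexStr c * rotMat a s + complexStr c) =
      (σ * (2 * (Real.sin s * Real.cos t))) • complexStr a
        + (σ * (2 * (Real.cos s * Real.sin t))) • complexStr b := by
    have htr : σ * (rotMat a s * rotMat b t).trace = 2 * Real.cos u := by
      rw [h, Matrix.trace_smul, trace_rotMat, smul_eq_mul, ← mul_assoc, ← pow_two, hσ, one_mul]
    rw [smul_add, hconj, hJc]
    have : σ • (rotMat b t * rotMat a s) - Real.cos u • 1 +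
        (σ • (rotMat a s * rotMat b t) - Real.cos u • 1) =
        σ • (rotMat a s * rotMat b t + rotMat b t * rotMat a s) - (2 * Real.cos u) • 1 := by module
    rw [this, hab, ← htr]
    module
  have ta : (complexStr a * (complexStr a * complexStr b)).trace = 0 := by
    rw [← mul_assoc, complexStr_mul_self, neg_one_mul, Matrix.trace_neg, trace_complexStr, neg_zero]
  have tb : (complexStr b * (complexStr a * complexStr b)).trace = 0 := by
    rw [Matrix.trace_mul_comm, mul_assoc, complexStr_mul_self, mul_neg_one, Matrix.trace_neg,
      trace_complexStr, neg_zero]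
  have e4 : Real.sin u * ((complexStr c * complexStr a * complexStr (rotSL a s • b)).trace
      + (complexStr c * complexStr a * complexStr b).trace) = 0 := by
    rw [e1, e2, ← Matrix.trace_add, ← add_mul, ← smul_eq_mul, ← Matrix.trace_smul,
      ← smul_mul_assoc, e3, add_mul, smul_mul_assoc, smul_mul_assoc, Matrix.trace_add,
      Matrix.trace_smul, Matrix.trace_smul, ta, tb, smul_zero, smul_zero, add_zero]
  rw [triDet_eq_trace, triDet_eq_trace]
  have := (mul_eq_zero.1 e4).resolve_left hu
  linarith

theorem areaForm_reflect {a b c : ℍ} {s t u : ℝ} (hu : Real.sin (u / 2) ≠ 0)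
    (h : rotAt a s * rotAt b t = rotAt c u) :
    areaForm c a (rotAt a s • b) = -areaForm c a b := by
  have h1 : triDet c a (rotAt a s • b) = -triDet c a b := by
    rw [rotAt, mk_smul]
    rcases rotAt_mul_eq_iff.1 h with h | h
    · exact triDet_rotSL_smul (σ := 1) hu (by norm_num) (by rw [h, one_smul])
    · exact triDet_rotSL_smul (σ := -1) hu (by norm_num) (by rw [h, neg_one_smul])
  have hiso : ∀ (A : G) (x y : ℍ), coshDist (A • x) (A • y) = coshDist x y := by
    intro A x y
    obtain ⟨g, rfl⟩ := QuotientGroup.mk_surjective A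
    exact coshDist_smul g x y
  have h2 : coshDist a (rotAt a s • b) = coshDist a b := by
    conv_lhs => rw [← rotAt_smul_self a s]
    rw [rotAt_smul_self a s, ← hiso (rotAt a s) a b, rotAt_smul_self]
  have h3 : coshDist (rotAt a s • b) c = coshDist b c := by
    have : rotAt a s • b = rotAt c u • b := by
      rw [← h, mul_smul, rotAt_smul_self]
    rw [this, ← hiso (rotAt c u) b c, rotAt_smul_self]
  rw [areaForm_eq, areaForm_eq, h1, h2, h3, neg_div, neg_div, neg_neg, ← mul_neg,
    ← Real.arctan_neg, neg_neg]

/-- The area of the triangle `z, T z, T S z` is that of three triangles with a side `[z, T z]`,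
`[T z, T S z]`, `[T S z, z]` and opposite vertices `a`, `T b`, `c`, plus that of the kite
`b, a, T b, c`, which is independent of `z`. -/
theorem areaForm_hexagon {T S : G} {a b c : ℍ} (hT : T • a = a) (hS : S • b = b)
    (hTS : (T * S) • c = c) (href : areaForm c a (T • b) = -areaForm c a b) (z : ℍ) :
    areaForm z (T • z) ((T * S) • z) =
      areaForm z (T • z) a + areaForm z (S • z) b - areaForm z ((T * S) • z) c
        - 2 * areaForm a b c := by
  have i1 := areaForm_smul T z (S • z) b
  have i2 := areaForm_smul T z a b
  have i3 := areaForm_smul (T * S) b z c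
  rw [hT] at i2
  rw [hTS, mul_smul, mul_smul, hS] at i3
  rw [mul_smul]
  simp only [areaForm] at *
  have s1 := arcPrimitive_swap
  linarith [s1 z (T • z), s1 z (S • z), s1 z (T • S • z), s1 z a, s1 z b, s1 z c, s1 a b, s1 a c,
    s1 b c, s1 (T • z) a, s1 (T • z) (T • b), s1 (T • z) (T • S • z), s1 (T • b) (T • S • z),
    s1 (T • b) a, s1 (T • b) c, s1 (T • S • z) c, s1 (S • z) b]

/-! ### Geodesic triangles in affine coordinates -/

/-- The squared modulus. In the coordinates `(re, sqNorm)` the geodesics are straight lines. -/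
def sqNorm (z : ℍ) : ℝ := z.re ^ 2 + z.im ^ 2

/-- Twice the signed Euclidean area of the triangle `a b p` in the coordinates `(re, sqNorm)`. For
`a.re < b.re` it is positive if and only if `p` lies above the geodesic through `a` and `b`. -/
def lineDet (a b p : ℍ) : ℝ :=
  (b.re - a.re) * (sqNorm p - sqNorm a) - (p.re - a.re) * (sqNorm b - sqNorm a)

theorem triDet_eq_lineDet (a b c : ℍ) :
    triDet a b c = lineDet a b c / (2 * a.im * b.im * c.im) := by
  simp only [triDet, lineDet, sqNorm]
  ring

theorem ext_of_re_sqNorm {a b : ℍ} (h : a.re = b.re) (h' : sqNorm a = sqNorm b) : a = b := by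
  refine ext_of_re_im h ?_
  have ha := a.im_pos
  have hb := b.im_pos
  simp only [sqNorm, h] at h'
  nlinarith

theorem exists_of_sq_lt {x u : ℝ} (h : x ^ 2 < u) : ∃ z : ℍ, z.re = x ∧ sqNorm z = u := by
  refine ⟨⟨⟨x, √(u - x ^ 2)⟩, Real.sqrt_pos.2 (by linarith)⟩, rfl, ?_⟩
  change x ^ 2 + √(u - x ^ 2) ^ 2 = u
  rw [Real.sq_sqrt (by linarith)]
  ring

theorem re_sq_lt_sqNorm (z : ℍ) : z.re ^ 2 < sqNorm z := by
  have := z.im_pos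
  rw [sqNorm]; nlinarith [sq_nonneg z.im, mul_pos this this]

theorem coshDist_of_affine {a b p : ℍ} {t : ℝ} (hx : p.re = (1 - t) * a.re + t * b.re)
    (hu : sqNorm p = (1 - t) * sqNorm a + t * sqNorm b) :
    coshDist a b - coshDist a p * coshDist p b =
      t * (1 - t) * (a.im * b.im / p.im ^ 2) * (coshDist a b ^ 2 - 1) ∧
    coshDist a p ^ 2 - 1 = (t * (b.im / p.im)) ^ 2 * (coshDist a b ^ 2 - 1) ∧
    coshDist p b ^ 2 - 1 = ((1 - t) * (a.im / p.im)) ^ 2 * (coshDist a b ^ 2 - 1) := by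
  have ha := a.im_ne_zero
  have hb := b.im_ne_zero
  have hp := p.im_ne_zero
  set α := (1 - t) * (a.im / p.im) with hα
  set β := t * (b.im / p.im) with hβ
  have h1 : coshDist a p = α + β * coshDist a b := by
    rw [hα, hβ]
    simp only [coshDist, sqNorm] at *
    field_simp
    linear_combination hu - 2 * a.re * hx
  have h2 : coshDist p b = α * coshDist a b + β := by
    rw [hα, hβ]
    simp only [coshDist, sqNorm] at *
    field_simp
    linear_combination hu - 2 * b.re * hx
  have h3 : α ^ 2 + β ^ 2 + 2 * α * β * coshDist a b = 1 := by
    rw [hα, hβ]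
    simp only [coshDist, sqNorm] at *
    field_simp
    have : p.im ^ 2 = (1 - t) * (a.re ^ 2 + a.im ^ 2) + t * (b.re ^ 2 + b.im ^ 2)
      - ((1 - t) * a.re + t * b.re) ^ 2 := by
      rw [hx] at hu; linarith
    rw [this]
    ring
  refine ⟨?_, ?_, ?_⟩
  · have : t * (1 - t) * (a.im * b.im / p.im ^ 2) = α * β := by
      rw [hα, hβ]; field_simp
    rw [this, h1, h2]
    linear_combination (-coshDist a b) * h3
  · rw [h1]; linear_combination h3
  · rw [h2]; linear_combination h3

theorem sinh_dist_sq (a b : ℍ) : Real.sinh (dist a b) ^ 2 = coshDist a b ^ 2 - 1 := by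
  rw [coshDist_eq, Real.cosh_sq]; ring

theorem sinh_dist_nonneg (a b : ℍ) : 0 ≤ Real.sinh (dist a b) := Real.sinh_nonneg_iff.2 dist_nonneg

/-- Geodesic segments are affine segments in the coordinates `(re, sqNorm)`. -/
theorem mem_segment_iff {a b p : ℍ} : p ∈ segment a b ↔ ∃ t ∈ Set.Icc (0 : ℝ) 1,
    p.re = (1 - t) * a.re + t * b.re ∧ sqNorm p = (1 - t) * sqNorm a + t * sqNorm b := by
  have hai := a.im_pos
  have hbi := b.im_pos
  have hpi := p.im_pos
  have hs1 := sinh_dist_nonneg a p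
  have hs2 := sinh_dist_nonneg p b
  have q1 := sinh_dist_sq a p
  have q2 := sinh_dist_sq p b
  change dist a p + dist p b = dist a b ↔ _
  constructor
  · intro h
    have h1 : coshDist a p * coshDist p b + Real.sinh (dist a p) * Real.sinh (dist p b) =
        coshDist a b := by
      rw [coshDist_eq, coshDist_eq, coshDist_eq, ← h, Real.cosh_add]
    have hdet : triDet a p b = 0 := by
      have h2 := triDet_sq a p b
      rw [coshDist_comm b a] at h2
      have h3 : (Real.sinh (dist a p) * Real.sinh (dist p b)) ^ 2 =
        (coshDist a b - coshDist a p * coshDist p b) ^ 2 := by rw [← h1]; ring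
      rw [mul_pow, q1, q2] at h3
      have : triDet a p b ^ 2 = 0 := by rw [h2]; linarith
      exact pow_eq_zero_iff two_ne_zero |>.1 this
    rw [triDet_eq_lineDet, div_eq_zero_iff, or_iff_left (by positivity), lineDet] at hdet
    by_cases hab : a = b
    · subst hab
      refine ⟨0, by simp, ?_⟩
      rw [dist_self] at h
      have : dist a p = 0 := by
        linarith [dist_nonneg (x := a) (y := p), dist_nonneg (x := p) (y := a)]
      rw [dist_eq_zero.1 this]; simp
    · have hex : ∃ t : ℝ, p.re = (1 - t) * a.re + t * b.re ∧
          sqNorm p = (1 - t) * sqNorm a + t * sqNorm b := by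
        by_cases hx : a.re = b.re
        · have hu : sqNorm b - sqNorm a ≠ 0 := fun h' =>
            hab (ext_of_re_sqNorm hx (by linarith))
          have h4 : p.re = a.re := by
            have : (p.re - a.re) * (sqNorm b - sqNorm a) = 0 := by
              linear_combination hdet - (sqNorm p - sqNorm a) * hx
            linarith [(mul_eq_zero.1 this).resolve_right hu]
          refine ⟨(sqNorm p - sqNorm a) / (sqNorm b - sqNorm a), ?_, ?_⟩
          · rw [h4, ← hx]; ring
          · field_simp; ring
        · have hx' : b.re - a.re ≠ 0 := fun h' => hx (by linarith)
          refine ⟨(p.re - a.re) / (b.re - a.re), ?_, ?_⟩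
          · field_simp; ring
          · field_simp; linarith
      obtain ⟨t, ht1, ht2⟩ := hex
      obtain ⟨e1, -, -⟩ := coshDist_of_affine ht1 ht2
      have hc := one_lt_coshDist hab
      have h5 : 0 ≤ t * (1 - t) * ((a.im * b.im / p.im ^ 2) * (coshDist a b ^ 2 - 1)) := by
        rw [← mul_assoc, ← e1, ← h1]
        linarith [mul_nonneg hs1 hs2]
      have h6 : 0 < (a.im * b.im / p.im ^ 2) * (coshDist a b ^ 2 - 1) :=
        mul_pos (by positivity) (by nlinarith)
      have h7 : 0 ≤ t * (1 - t) := by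
        by_contra! h'
        nlinarith
      exact ⟨t, ⟨by nlinarith, by nlinarith⟩, ht1, ht2⟩
  · rintro ⟨t, ⟨ht0, ht1⟩, hx, hu⟩
    obtain ⟨e1, e2, e3⟩ := coshDist_of_affine hx hu
    rw [← sinh_dist_sq a b] at e1 e2 e3
    rw [← q1, ← mul_pow] at e2
    rw [← q2, ← mul_pow] at e3
    have h3 := sinh_dist_nonneg a b
    have h1t : 0 ≤ 1 - t := by linarith
    have f2 := (sq_eq_sq₀ hs1 (by positivity)).1 e2
    have f3 := (sq_eq_sq₀ hs2 (by positivity)).1 e3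
    have : Real.cosh (dist a p + dist p b) = Real.cosh (dist a b) := by
      rw [Real.cosh_add, ← coshDist_eq, ← coshDist_eq, ← coshDist_eq, f2, f3]
      have e : t * (b.im / p.im) * Real.sinh (dist a b) * ((1 - t) * (a.im / p.im) *
          Real.sinh (dist a b)) = t * (1 - t) * (a.im * b.im / p.im ^ 2) *
          Real.sinh (dist a b) ^ 2 := by field_simp
      rw [e, ← e1]; ring
    exact Real.cosh_injOn (Set.mem_Ici.2 (by positivity)) (Set.mem_Ici.2 dist_nonneg) this

/-- Geodesic triangles are affine triangles in the coordinates `(re, sqNorm)`. -/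
theorem mem_triangle_iff {a b c p : ℍ} : p ∈ triangle a b c ↔
    ∃ r s t : ℝ, 0 ≤ r ∧ 0 ≤ s ∧ 0 ≤ t ∧ r + s + t = 1 ∧
      p.re = r * a.re + s * b.re + t * c.re ∧
      sqNorm p = r * sqNorm a + s * sqNorm b + t * sqNorm c := by
  simp only [triangle, Set.mem_iUnion, exists_prop, mem_segment_iff]
  constructor
  · rintro ⟨q, ⟨t, ⟨ht0, ht1⟩, hx, hu⟩, t', ⟨ht0', ht1'⟩, hx', hu'⟩
    refine ⟨1 - t', t' * (1 - t), t' * t, by linarith, mul_nonneg ht0' (by linarith),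
      mul_nonneg ht0' ht0, by ring, ?_, ?_⟩
    · rw [hx', hx]; ring
    · rw [hu', hu]; ring
  · rintro ⟨r, s, t, hr, hs, ht, hsum, hx, hu⟩
    by_cases h0 : s + t = 0
    · have hs0 : s = 0 := by linarith
      have ht0 : t = 0 := by linarith
      have hr1 : r = 1 := by linarith
      refine ⟨b, ⟨0, by simp, by simp, by simp⟩, 0, by simp, ?_, ?_⟩
      · rw [hx, hs0, ht0, hr1]; ring
      · rw [hu, hs0, ht0, hr1]; ring
    · have hpos : 0 < s + t := lt_of_le_of_ne (by linarith) (Ne.symm h0)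
      have htt : 0 ≤ t / (s + t) := by positivity
      have htt1 : t / (s + t) ≤ 1 := by rw [div_le_one hpos]; linarith
      set τ := t / (s + t) with hτ
      have hlt : ((1 - τ) * b.re + τ * c.re) ^ 2 < (1 - τ) * sqNorm b + τ * sqNorm c := by
        have hb := re_sq_lt_sqNorm b
        have hc := re_sq_lt_sqNorm c
        have : 0 ≤ τ * (1 - τ) * (b.re - c.re) ^ 2 :=
          mul_nonneg (mul_nonneg htt (by linarith)) (sq_nonneg _)
        rcases eq_or_lt_of_le htt with h | h
        · rw [← h]; simpa using hb
        · nlinarith [mul_pos h (sub_pos.2 hc), mul_nonneg (sub_nonneg.2 htt1) (sub_pos.2 hb).le]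
      obtain ⟨q, hqx, hqu⟩ := exists_of_sq_lt hlt
      refine ⟨q, ⟨τ, ⟨htt, htt1⟩, hqx, hqu⟩, s + t, ⟨hpos.le, by linarith⟩, ?_, ?_⟩
      · rw [hqx, hx, hτ, show r = 1 - (s + t) by linarith]; field_simp; ring
      · rw [hqu, hu, hτ, show r = 1 - (s + t) by linarith]; field_simp; ring

theorem triangle_rotate (a b c : ℍ) : triangle b c a = triangle a b c := by
  ext p
  rw [mem_triangle_iff, mem_triangle_iff]
  constructor
  · rintro ⟨r, s, t, hr, hs, ht, h1, h2, h3⟩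
    exact ⟨t, r, s, ht, hr, hs, by linarith, by linarith, by linarith⟩
  · rintro ⟨r, s, t, hr, hs, ht, h1, h2, h3⟩
    exact ⟨s, t, r, hs, ht, hr, by linarith, by linarith, by linarith⟩

theorem triangle_swap (a b c : ℍ) : triangle b a c = triangle a b c := by
  ext p
  rw [mem_triangle_iff, mem_triangle_iff]
  constructor
  · rintro ⟨r, s, t, hr, hs, ht, h1, h2, h3⟩
    exact ⟨s, r, t, hs, hr, ht, by linarith, by linarith, by linarith⟩
  · rintro ⟨r, s, t, hr, hs, ht, h1, h2, h3⟩
    exact ⟨s, r, t, hs, hr, ht, by linarith, by linarith, by linarith⟩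

/-- A nondegenerate triangle is an intersection of three half-planes, since the barycentric
coordinates of `p` are quotients of determinants. -/
theorem mem_triangle_iff_lineDet {a b c p : ℍ} (hK : lineDet a b c ≠ 0) : p ∈ triangle a b c ↔
    0 ≤ lineDet a b p / lineDet a b c ∧ 0 ≤ lineDet b c p / lineDet a b c ∧
      0 ≤ lineDet c a p / lineDet a b c := by
  rw [mem_triangle_iff]
  constructor
  · rintro ⟨r, s, t, hr, hs, ht, h1, h2, h3⟩
    have hr1 : r = 1 - s - t := by linarith
    have e1 : lineDet a b p = t * lineDet a b c := by
      simp only [lineDet, h2, h3, hr1]; ring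
    have e2 : lineDet b c p = r * lineDet a b c := by
      simp only [lineDet, h2, h3, hr1]; ring
    have e3 : lineDet c a p = s * lineDet a b c := by
      simp only [lineDet, h2, h3, hr1]; ring
    rw [e1, e2, e3, mul_div_cancel_right₀ _ hK, mul_div_cancel_right₀ _ hK,
      mul_div_cancel_right₀ _ hK]
    exact ⟨ht, hr, hs⟩
  · rintro ⟨h1, h2, h3⟩
    refine ⟨_, _, _, h2, h3, h1, ?_, ?_, ?_⟩
    · field_simp; simp only [lineDet]; ring
    · field_simp; simp only [lineDet]; ring
    · field_simp; simp only [lineDet]; ring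

/-! ### The area above a geodesic -/

theorem measurable_re : Measurable UpperHalfPlane.re :=
  Complex.measurable_re.comp UpperHalfPlane.measurable_coe

theorem measurable_im : Measurable UpperHalfPlane.im :=
  Complex.measurable_im.comp UpperHalfPlane.measurable_coe

theorem measurable_sqNorm : Measurable sqNorm :=
  (measurable_re.pow_const 2).add (measurable_im.pow_const 2)

/-- The hyperbolic area as an iterated integral. -/
theorem volume_eq_lintegral_lintegral {s : Set ℍ} (hs : MeasurableSet s) :
    volume s = ∫⁻ x : ℝ, ∫⁻ y in {y : ℝ | ∃ z ∈ s, z.re = x ∧ z.im = y},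
      ENNReal.ofReal (1 / y ^ 2) := by
  have himg : MeasurableSet (UpperHalfPlane.coe '' s) :=
    UpperHalfPlane.measurableEmbedding_coe.measurableSet_image.2 hs
  have hmeas : Measurable fun z : ℂ => ENNReal.ofReal (1 / z.im ^ 2) := by fun_prop
  have h1 : volume s = ∫⁻ z : ℂ in UpperHalfPlane.coe '' s, ENNReal.ofReal (1 / z.im ^ 2) := by
    rw [UpperHalfPlane.volume_eq_lintegral]
    congr 1
    ext z
    rw [← ENNReal.ofReal_coe_nnreal]
    congr 1
    simp
  rw [h1, ← lintegral_indicator himg,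
    ← Complex.volume_preserving_equiv_real_prod.symm.lintegral_comp
      (hmeas.indicator himg),
    Measure.volume_eq_prod, lintegral_prod _ (by
      exact ((hmeas.indicator himg).comp
        Complex.measurableEquivRealProd.symm.measurable).aemeasurable)]
  refine lintegral_congr fun x => ?_
  have hset : ∀ y : ℝ, Complex.measurableEquivRealProd.symm (x, y) ∈ UpperHalfPlane.coe '' s ↔
      y ∈ {y : ℝ | ∃ z ∈ s, z.re = x ∧ z.im = y} := by
    intro y
    constructor
    · rintro ⟨z, hz, h⟩
      exact ⟨z, hz, congrArg Complex.re h, congrArg Complex.im h⟩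
    · rintro ⟨z, hz, h, h'⟩
      exact ⟨z, hz, Complex.ext h h'⟩
  have hm : MeasurableSet {y : ℝ | ∃ z ∈ s, z.re = x ∧ z.im = y} := by
    have : {y : ℝ | ∃ z ∈ s, z.re = x ∧ z.im = y} =
        (fun y : ℝ => Complex.measurableEquivRealProd.symm (x, y)) ⁻¹'
          (UpperHalfPlane.coe '' s) := by
      ext y; exact (hset y).symm
    rw [this]
    exact (Complex.measurableEquivRealProd.symm.measurable.comp measurable_prodMk_left) himg
  rw [← lintegral_indicator hm]
  refine lintegral_congr fun y => ?_
  by_cases h : y ∈ {y : ℝ | ∃ z ∈ s, z.re = x ∧ z.im = y}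
  · rw [Set.indicator_of_mem h, Set.indicator_of_mem ((hset y).2 h)]
    rfl
  · rw [Set.indicator_of_notMem h, Set.indicator_of_notMem (fun h' => h ((hset y).1 h'))]

theorem volume_re_eq (x : ℝ) : volume {z : ℍ | z.re = x} = 0 := by
  rw [volume_eq_lintegral_lintegral (measurableSet_eq_fun measurable_re measurable_const),
    lintegral_eq_zero_of_ae_eq_zero]
  have : ∀ᵐ y : ℝ, y ≠ x := by simp [ae_iff]
  filter_upwards [this] with y hy
  refine setLIntegral_measure_zero _ _ (measure_mono_null (t := ∅) ?_ measure_empty)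
  rintro y' ⟨z, hz, hz', -⟩
  exact hy (hz' ▸ hz)

theorem lintegral_Ioi_one_div_sq {k : ℝ} (hk : 0 < k) :
    ∫⁻ y in Set.Ioi k, ENNReal.ofReal (1 / y ^ 2) = ENNReal.ofReal (1 / k) := by
  have h0 : ∀ y ∈ Set.Ioi k, (1 : ℝ) / y ^ 2 = y ^ (-2 : ℝ) := by
    intro y hy
    have : 0 < y := hk.trans hy
    rw [Real.rpow_neg this.le, one_div]; norm_cast
  have hi := integrableOn_Ioi_rpow_of_lt (a := -2) (by norm_num) hk
  have hi' : IntegrableOn (fun y : ℝ => 1 / y ^ 2) (Set.Ioi k) :=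
    hi.congr_fun (fun y hy => (h0 y hy).symm) measurableSet_Ioi
  rw [← ofReal_integral_eq_lintegral_ofReal hi'
    (Filter.Eventually.of_forall fun y => by positivity),
    setIntegral_congr_fun measurableSet_Ioi h0, integral_Ioi_rpow_of_lt (by norm_num) hk]
  congr 1
  norm_num
  rw [Real.rpow_neg_one]

/-- Along the geodesic `x² + y² = A + B x` from `x0 + i y0`, the function on the left is a primitive
of `1 / y`. -/
theorem hasDerivAt_arctan_chord {x0 y0 A B x : ℝ} (hy0 : 0 < y0)
    (hx : 0 < A + B * x - x ^ 2) (h0 : A + B * x0 = x0 ^ 2 + y0 ^ 2) :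
    HasDerivAt (fun x => 2 * Real.arctan ((x - x0) / (y0 + √(A + B * x - x ^ 2))))
      (1 / √(A + B * x - x ^ 2)) x := by
  set w := √(A + B * x - x ^ 2) with hw
  have hw0 : 0 < w := Real.sqrt_pos.2 hx
  have hw2 : w ^ 2 = A + B * x - x ^ 2 := Real.sq_sqrt hx.le
  have h1 : HasDerivAt (fun x : ℝ => A + B * x - x ^ 2) (B - 2 * x) x := by
    have := (((hasDerivAt_id x).const_mul B).const_add A).fun_sub (hasDerivAt_pow 2 x)
    simpa using this
  have h2 := h1.sqrt hx.ne'
  have h3 := (((hasDerivAt_id x).sub_const x0).fun_div (h2.const_add y0)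
    (by positivity)).arctan.const_mul 2
  refine h3.congr_deriv ?_
  simp only [id, ← hw]
  have hpos : 0 < y0 + w := by positivity
  have hA : A = x0 ^ 2 + y0 ^ 2 - B * x0 := by linarith
  have hden : 0 < (y0 + w) ^ 2 + (x - x0) ^ 2 := by positivity
  rw [hA] at hw2
  have e : (y0 + w) ^ 2 + (x - x0) ^ 2 = 2 * w * (y0 + w) - (x - x0) * (B - 2 * x) := by
    linear_combination (-1 : ℝ) * hw2
  have e' : 2 * (1 / (1 + ((x - x0) / (y0 + w)) ^ 2) *
      ((1 * (y0 + w) - (x - x0) * ((B - 2 * x) / (2 * w))) / (y0 + w) ^ 2)) =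
      (2 * w * (y0 + w) - (x - x0) * (B - 2 * x)) / (w * ((y0 + w) ^ 2 + (x - x0) ^ 2)) := by
    field_simp
  rw [e', ← e, div_eq_div_iff (by positivity) hw0.ne']
  ring

theorem lintegral_inv_chord {x0 y0 x1 y1 A B : ℝ} (hle : x0 ≤ x1) (hy0 : 0 < y0) (hy1 : 0 < y1)
    (h0 : A + B * x0 = x0 ^ 2 + y0 ^ 2) (h1 : A + B * x1 = x1 ^ 2 + y1 ^ 2)
    (hpos : ∀ x ∈ Set.Icc x0 x1, 0 < A + B * x - x ^ 2) :
    ∫⁻ x in Set.Ioc x0 x1, ENNReal.ofReal (1 / √(A + B * x - x ^ 2)) =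
      ENNReal.ofReal (2 * Real.arctan ((x1 - x0) / (y0 + y1))) := by
  have hcont : ContinuousOn (fun x => 1 / √(A + B * x - x ^ 2)) (Set.Icc x0 x1) := by
    refine ContinuousOn.div continuousOn_const (by fun_prop) fun x hx => ?_
    exact (Real.sqrt_pos.2 (hpos x hx)).ne'
  have hint : IntervalIntegrable (fun x => 1 / √(A + B * x - x ^ 2)) volume x0 x1 :=
    (hcont.mono (by rw [Set.uIcc_of_le hle])).intervalIntegrable
  rw [← ofReal_integral_eq_lintegral_ofReal
    ((intervalIntegrable_iff_integrableOn_Ioc_of_le hle).1 hint)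
    (Filter.Eventually.of_forall fun x => by positivity),
    ← intervalIntegral.integral_of_le hle,
    intervalIntegral.integral_eq_sub_of_hasDerivAt
      (f := fun x => 2 * Real.arctan ((x - x0) / (y0 + √(A + B * x - x ^ 2)))) ?_ hint]
  · congr 1
    rw [h1, show x1 ^ 2 + y1 ^ 2 - x1 ^ 2 = y1 ^ 2 by ring, Real.sqrt_sq hy1.le]
    simp
  · intro x hx
    rw [Set.uIcc_of_le hle] at hx
    exact hasDerivAt_arctan_chord hy0 (hpos x hx) h0

/-- The area of the region above the geodesic segment from `a` to `b`. The set `s` may contain any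
part of the segment itself. -/
theorem volume_above_chord {a b : ℍ} (hab : a.re ≤ b.re) {s : Set ℍ} (hs : MeasurableSet s)
    (h1 : ∀ p ∈ s, a.re < p.re ∧ p.re ≤ b.re ∧ 0 ≤ lineDet a b p)
    (h2 : ∀ p : ℍ, a.re < p.re → p.re ≤ b.re → 0 < lineDet a b p → p ∈ s) :
    volume s = ENNReal.ofReal (2 * arcPrimitive b a) := by
  rcases eq_or_lt_of_le hab with heq | hlt
  · have : s = ∅ := by
      ext p
      simp only [Set.mem_empty_iff_false, iff_false]
      intro hp
      have := h1 p hp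
      linarith [this.1, this.2.1]
    rw [this, measure_empty, arcPrimitive, heq]
    simp
  have hd : 0 < b.re - a.re := by linarith
  set B := (sqNorm b - sqNorm a) / (b.re - a.re) with hB
  set A := sqNorm a - B * a.re with hA
  have hline : ∀ p : ℍ, lineDet a b p = (b.re - a.re) * (sqNorm p - (A + B * p.re)) := by
    intro p; rw [hA, hB, lineDet]; field_simp; ring
  have hA0 : A + B * a.re = a.re ^ 2 + a.im ^ 2 := by rw [hA, sqNorm]; ring
  have hA1 : A + B * b.re = b.re ^ 2 + b.im ^ 2 := by
    rw [hA, hB, ← sqNorm]; field_simp; ring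
  have hpos : ∀ x ∈ Set.Icc a.re b.re, 0 < A + B * x - x ^ 2 := by
    rintro x ⟨hx0, hx1⟩
    have e : (b.re - a.re) * (A + B * x - x ^ 2) = a.im ^ 2 * (b.re - x) + b.im ^ 2 * (x - a.re)
        + (b.re - a.re) * ((b.re - x) * (x - a.re)) := by
      linear_combination (b.re - x) * hA0 + (x - a.re) * hA1
    have hai : 0 < a.im ^ 2 := pow_pos a.im_pos 2
    have hbi : 0 < b.im ^ 2 := pow_pos b.im_pos 2
    have f1 : 0 ≤ (b.re - a.re) * ((b.re - x) * (x - a.re)) :=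
      mul_nonneg hd.le (mul_nonneg (by linarith) (by linarith))
    have f2 : 0 < a.im ^ 2 * (b.re - x) + b.im ^ 2 * (x - a.re) := by
      rcases eq_or_lt_of_le hx0 with h | h
      · rw [← h]; have := mul_pos hai hd; simpa using this
      · exact add_pos_of_nonneg_of_pos (mul_nonneg hai.le (by linarith)) (mul_pos hbi (by linarith))
    have f3 : 0 < (b.re - a.re) * (A + B * x - x ^ 2) := by rw [e]; linarith
    exact pos_of_mul_pos_right f3 hd.le
  have hint := lintegral_inv_chord hab a.im_pos b.im_pos hA0 hA1 hpos
  rw [arcPrimitive, add_comm b.im, ← hint, volume_eq_lintegral_lintegral hs,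
    ← lintegral_indicator measurableSet_Ioc]
  refine lintegral_congr fun x => ?_
  by_cases hx : x ∈ Set.Ioc a.re b.re
  · rw [Set.indicator_of_mem hx]
    have hp := hpos x ⟨hx.1.le, hx.2⟩
    set k := √(A + B * x - x ^ 2) with hk
    have hk0 : 0 < k := Real.sqrt_pos.2 hp
    have hk2 : k ^ 2 = A + B * x - x ^ 2 := Real.sq_sqrt hp.le
    rw [← lintegral_Ioi_one_div_sq hk0]
    refine setLIntegral_congr ?_
    have hsub1 : Set.Ioi k ⊆ {y : ℝ | ∃ z ∈ s, z.re = x ∧ z.im = y} := by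
      intro y hy
      have hy' : k < y := hy
      refine ⟨⟨⟨x, y⟩, hk0.trans hy'⟩, ?_, rfl, rfl⟩
      refine h2 _ hx.1 hx.2 ?_
      rw [hline]
      refine mul_pos hd ?_
      change 0 < x ^ 2 + y ^ 2 - (A + B * x)
      nlinarith
    have hsub2 : {y : ℝ | ∃ z ∈ s, z.re = x ∧ z.im = y} ⊆ Set.Ici k := by
      rintro y ⟨z, hz, rfl, rfl⟩
      have := (h1 z hz).2.2
      rw [hline] at this
      have h3 := nonneg_of_mul_nonneg_right this hd
      rw [sqNorm] at h3
      have := z.im_pos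
      change k ≤ z.im
      nlinarith
    exact Filter.EventuallyLE.antisymm
      (hsub2.eventuallyLE.trans Ioi_ae_eq_Ici.symm.le) hsub1.eventuallyLE
  · rw [Set.indicator_of_notMem hx]
    refine setLIntegral_measure_zero _ _ (measure_mono_null (t := ∅) ?_ measure_empty)
    rintro y ⟨z, hz, rfl, -⟩
    exact hx ⟨(h1 z hz).1, (h1 z hz).2.1⟩

/-! ### The area of a triangle -/

theorem measurable_lineDet (a b : ℍ) : Measurable (lineDet a b) := by
  unfold lineDet
  exact ((measurable_sqNorm.sub_const _).const_mul _).sub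
    ((measurable_re.sub_const _).mul_const _)

/-- The points above the geodesic from `a` to `b`, or on it. The left end of the range of `re` is
excluded, so that the regions above adjacent segments are disjoint. -/
def aboveChord (a b : ℍ) : Set ℍ := {p | a.re < p.re ∧ p.re ≤ b.re ∧ 0 ≤ lineDet a b p}

/-- The points strictly above the geodesic from `a` to `b`. -/
def strictlyAboveChord (a b : ℍ) : Set ℍ := {p | a.re < p.re ∧ p.re ≤ b.re ∧ 0 < lineDet a b p}

theorem measurableSet_aboveChord (a b : ℍ) : MeasurableSet (aboveChord a b) :=
  (measurableSet_lt measurable_const measurable_re).inter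
    ((measurableSet_le measurable_re measurable_const).inter
      (measurableSet_le measurable_const (measurable_lineDet a b)))

theorem measurableSet_strictlyAboveChord (a b : ℍ) : MeasurableSet (strictlyAboveChord a b) :=
  (measurableSet_lt measurable_const measurable_re).inter
    ((measurableSet_le measurable_re measurable_const).inter
      (measurableSet_lt measurable_const (measurable_lineDet a b)))

theorem volume_aboveChord {a b : ℍ} (h : a.re ≤ b.re) :
    volume (aboveChord a b) = ENNReal.ofReal (2 * arcPrimitive b a) :=
  volume_above_chord h (measurableSet_aboveChord a b) (fun _ hp => hp)
    fun _ h1 h2 h3 => ⟨h1, h2, h3.le⟩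

theorem volume_strictlyAboveChord {a b : ℍ} (h : a.re ≤ b.re) :
    volume (strictlyAboveChord a b) = ENNReal.ofReal (2 * arcPrimitive b a) :=
  volume_above_chord h (measurableSet_strictlyAboveChord a b)
    (fun _ hp => ⟨hp.1, hp.2.1, hp.2.2.le⟩) fun _ h1 h2 h3 => ⟨h1, h2, h3⟩

theorem arcPrimitive_nonneg {a b : ℍ} (h : a.re ≤ b.re) : 0 ≤ arcPrimitive b a := by
  have := a.im_pos
  have := b.im_pos
  exact Real.arctan_nonneg.2 (div_nonneg (by linarith) (by positivity))

theorem lineDet_swap (a b p : ℍ) : lineDet b a p = -lineDet a b p := by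
  simp only [lineDet]; ring

theorem area_eq_of_volume {a b c : ℍ} {x y : ℝ}
    (hy : 0 ≤ y) (hx : 0 ≤ x)
    (h : volume (triangle a b c ∩ {p | a.re < p.re}) + ENNReal.ofReal y = ENNReal.ofReal x)
    (hle : ∀ p ∈ triangle a b c, a.re ≤ p.re) : area a b c = x - y := by
  have h1 : volume (triangle a b c) = volume (triangle a b c ∩ {p | a.re < p.re}) := by
    refine le_antisymm ?_ (measure_mono Set.inter_subset_left)
    refine (measure_mono (t := (triangle a b c ∩ {p | a.re < p.re}) ∪ {p | p.re = a.re}) ?_).trans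
      ((measure_union_le _ _).trans ?_)
    · intro p hp
      rcases eq_or_lt_of_le (hle p hp) with h | h
      · exact Or.inr h.symm
      · exact Or.inl ⟨hp, h⟩
    · rw [volume_re_eq, add_zero]
  rw [area, Measure.real, h1]
  have h2 : volume (triangle a b c ∩ {p | a.re < p.re}) ≠ ⊤ := by
    intro htop
    rw [htop, top_add] at h
    exact ENNReal.ofReal_ne_top h.symm
  have h3 := congrArg ENNReal.toReal h
  rw [ENNReal.toReal_add h2 ENNReal.ofReal_ne_top, ENNReal.toReal_ofReal hy,
    ENNReal.toReal_ofReal hx] at h3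
  linarith

/-- For vertices sorted by real part, the triangle lies between the side `a c` and the broken line
`a b c`, so its area is a difference of areas of regions above geodesic segments. -/
theorem area_eq_of_sorted {a b c : ℍ} (hab : a.re ≤ b.re) (hbc : b.re ≤ c.re)
    (hK : lineDet a b c ≠ 0) : area a b c = |areaForm a b c| := by
  have hD := triDet_eq_lineDet a b c
  have hai := a.im_pos
  have hbi := b.im_pos
  have hci := c.im_pos
  have hden : 0 < 2 * a.im * b.im * c.im := by positivity
  have hac : a.re < c.re := by
    refine lt_of_le_of_ne (hab.trans hbc) fun h => hK ?_
    have h1 : b.re = a.re := by linarith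
    simp only [lineDet, h1, h]; ring
  have hle : ∀ p ∈ triangle a b c, a.re ≤ p.re := by
    intro p hp
    obtain ⟨r, s, t, hr, hs, ht, h1, h2, -⟩ := mem_triangle_iff.1 hp
    rw [h2, show r = 1 - s - t by linarith]
    nlinarith [mul_nonneg hs (sub_nonneg.2 hab), mul_nonneg ht (sub_nonneg.2 hac.le)]
  have hle' : ∀ p ∈ triangle a b c, p.re ≤ c.re := by
    intro p hp
    obtain ⟨r, s, t, hr, hs, ht, h1, h2, -⟩ := mem_triangle_iff.1 hp
    rw [h2, show t = 1 - r - s by linarith]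
    nlinarith [mul_nonneg hs (sub_nonneg.2 hbc), mul_nonneg hr (sub_nonneg.2 hac.le)]
  have hmem := fun p => mem_triangle_iff_lineDet (p := p) hK
  -- Linear relations between the barycentric coordinates of `p`, one of them eliminated.
  have e1 : ∀ p : ℍ, lineDet a b p * (c.re - a.re) =
      lineDet a b c * (p.re - a.re) - lineDet c a p * (b.re - a.re) := by
    intro p; simp only [lineDet]; ring
  have e2 : ∀ p : ℍ, lineDet b c p * (c.re - a.re) =
      lineDet a b c * (c.re - p.re) - lineDet c a p * (c.re - b.re) := by
    intro p; simp only [lineDet]; ring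
  have e3 : ∀ p : ℍ, lineDet b c p * (b.re - a.re) =
      lineDet a b c * (b.re - p.re) + lineDet a b p * (c.re - b.re) := by
    intro p; simp only [lineDet]; ring
  have hac' : 0 < c.re - a.re := by linarith
  have v1 := arcPrimitive_nonneg hab
  have v2 := arcPrimitive_nonneg hbc
  have v3 := arcPrimitive_nonneg hac.le
  have harea : areaForm a b c =
      2 * arcPrimitive c a - (2 * arcPrimitive b a + 2 * arcPrimitive c b) := by
    rw [areaForm, arcPrimitive_swap b a, arcPrimitive_swap c b]; ring
  have hdisj : ∀ p ∈ strictlyAboveChord a b, p ∉ strictlyAboveChord b c := by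
    intro p hp hp'
    linarith [hp.2.1, hp'.1]
  -- If `b` lies above the side `ac`, the region above `ac` is the union of the triangle and the
  -- regions above `ab` and `bc`. If `b` lies below, the regions above `ab` and `bc` together are
  -- the union of the triangle and the region above `ac`.
  rcases lt_or_gt_of_ne hK with hneg | hpos
  · have hdiv : ∀ v : ℝ, 0 ≤ v / lineDet a b c ↔ v ≤ 0 := fun v => by
      rw [le_div_iff_of_neg hneg, zero_mul]
    simp only [hdiv] at hmem
    have hset : aboveChord a c = (triangle a b c ∩ {p | a.re < p.re}) ∪
        (strictlyAboveChord a b ∪ strictlyAboveChord b c) := by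
      ext p
      have d1 := e1 p
      have d2 := e2 p
      have d3 := e3 p
      have d4 := lineDet_swap a c p
      constructor
      · rintro ⟨h1, h2, h3⟩
        rcases le_or_gt p.re b.re with hx | hx
        · rcases le_or_gt (lineDet a b p) 0 with h | h
          · refine Or.inl ⟨(hmem p).2 ⟨h, ?_, by linarith⟩, h1⟩
            have : 0 < b.re - a.re := by linarith
            nlinarith [mul_nonneg (neg_nonneg.2 hneg.le) (sub_nonneg.2 hx),
              mul_nonneg (neg_nonneg.2 h) (sub_nonneg.2 hbc)]
          · exact Or.inr (Or.inl ⟨h1, hx, h⟩)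
        · rcases le_or_gt (lineDet b c p) 0 with h | h
          · refine Or.inl ⟨(hmem p).2 ⟨?_, h, by linarith⟩, h1⟩
            have : 0 < c.re - b.re := by linarith
            nlinarith [mul_nonneg (neg_nonneg.2 hneg.le) (sub_nonneg.2 hx.le),
              mul_nonneg (neg_nonneg.2 h) (sub_nonneg.2 hab)]
          · exact Or.inr (Or.inr ⟨hx, h2, h⟩)
      · rintro (⟨hp, h1⟩ | ⟨h1, h2, h3⟩ | ⟨h1, h2, h3⟩)
        · exact ⟨h1, hle' p hp, by linarith [((hmem p).1 hp).2.2]⟩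
        · refine ⟨h1, h2.trans hbc, ?_⟩
          have : 0 < b.re - a.re := by linarith
          have : 0 < lineDet a b p * (c.re - a.re) := mul_pos h3 hac'
          have := mul_nonneg (neg_nonneg.2 hneg.le) (sub_nonneg.2 h1.le)
          by_contra! h
          nlinarith
        · refine ⟨lt_of_le_of_lt hab h1, h2, ?_⟩
          have : 0 < c.re - b.re := by linarith
          have : 0 < lineDet b c p * (c.re - a.re) := mul_pos h3 hac'
          have := mul_nonneg (neg_nonneg.2 hneg.le) (sub_nonneg.2 h2)
          by_contra! h
          nlinarith
    have hvol := volume_aboveChord hac.le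
    rw [hset, measure_union ?_ ((measurableSet_strictlyAboveChord a b).union
      (measurableSet_strictlyAboveChord b c)), measure_union ?_
      (measurableSet_strictlyAboveChord b c), volume_strictlyAboveChord hab,
      volume_strictlyAboveChord hbc, ← ENNReal.ofReal_add (by positivity) (by positivity)] at hvol
    · have h0 := area_eq_of_volume (by positivity) (by positivity) hvol hle
      rw [← harea] at h0
      have hA := (areaForm_mem_Ioo (a := a) (b := b) (c := c)
        (by rw [hD]; exact div_neg_of_neg_of_pos hneg hden)).1
      rw [h0, abs_of_pos hA]
    · exact Set.disjoint_left.2 hdisj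
    · refine Set.disjoint_left.2 ?_
      rintro p ⟨hp, -⟩ (h | h)
      · exact absurd ((hmem p).1 hp).1 (not_le.2 h.2.2)
      · exact absurd ((hmem p).1 hp).2.1 (not_le.2 h.2.2)
  · have hdiv : ∀ v : ℝ, 0 ≤ v / lineDet a b c ↔ 0 ≤ v := fun v => by
      rw [le_div_iff₀ hpos, zero_mul]
    simp only [hdiv] at hmem
    have hset : aboveChord a b ∪ aboveChord b c = (triangle a b c ∩ {p | a.re < p.re}) ∪
        strictlyAboveChord a c := by
      ext p
      have d1 := e1 p
      have d2 := e2 p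
      have d3 := e3 p
      have d4 := lineDet_swap a c p
      constructor
      · rintro (⟨h1, h2, h3⟩ | ⟨h1, h2, h3⟩)
        · rcases le_or_gt (lineDet a c p) 0 with h | h
          · refine Or.inl ⟨(hmem p).2 ⟨h3, ?_, by linarith⟩, h1⟩
            have : 0 < b.re - a.re := by linarith
            nlinarith [mul_nonneg hpos.le (sub_nonneg.2 h2), mul_nonneg h3 (sub_nonneg.2 hbc)]
          · exact Or.inr ⟨h1, h2.trans hbc, h⟩
        · rcases le_or_gt (lineDet a c p) 0 with h | h
          · refine Or.inl ⟨(hmem p).2 ⟨?_, h3, by linarith⟩, lt_of_le_of_lt hab h1⟩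
            have : 0 < c.re - b.re := by linarith
            nlinarith [mul_nonneg hpos.le (sub_nonneg.2 h1.le), mul_nonneg h3 (sub_nonneg.2 hab)]
          · exact Or.inr ⟨lt_of_le_of_lt hab h1, h2, h⟩
      · rintro (⟨hp, h1⟩ | ⟨h1, h2, h3⟩)
        · have hp' := (hmem p).1 hp
          rcases le_or_gt p.re b.re with hx | hx
          · exact Or.inl ⟨h1, hx, hp'.1⟩
          · exact Or.inr ⟨hx, hle' p hp, hp'.2.1⟩
        · rcases le_or_gt p.re b.re with hx | hx
          · refine Or.inl ⟨h1, hx, ?_⟩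
            nlinarith [mul_nonneg hpos.le (sub_nonneg.2 h1.le), mul_nonneg h3.le (sub_nonneg.2 hab)]
          · refine Or.inr ⟨hx, h2, ?_⟩
            nlinarith [mul_nonneg hpos.le (sub_nonneg.2 h2), mul_nonneg h3.le (sub_nonneg.2 hbc)]
    have hvol : volume (aboveChord a b ∪ aboveChord b c) = _ :=
      measure_union (Set.disjoint_left.2 fun p hp hp' => by linarith [hp.2.1, hp'.1])
        (measurableSet_aboveChord b c)
    rw [hset, measure_union ?_ (measurableSet_strictlyAboveChord a c),
      volume_strictlyAboveChord hac.le, volume_aboveChord hab, volume_aboveChord hbc,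
      ← ENNReal.ofReal_add (by positivity) (by positivity)] at hvol
    · have h0 := area_eq_of_volume (by positivity) (by positivity) hvol hle
      have hA := (areaForm_mem_Ioo (a := b) (b := a) (c := c)
        (by rw [triDet_swap, hD, neg_lt_zero]; exact div_pos hpos hden)).1
      rw [areaForm_swap] at hA
      rw [h0, abs_of_neg (by linarith), harea]
      ring
    · refine Set.disjoint_left.2 ?_
      rintro p ⟨hp, -⟩ h
      have h1 := ((hmem p).1 hp).2.2
      rw [lineDet_swap] at h1
      linarith [h.2.2]

theorem area_eq {a b c : ℍ} (hD : triDet a b c ≠ 0) : area a b c = |areaForm a b c| := by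
  have hrot : ∀ x y z : ℍ, area y z x = area x y z := fun x y z => by
    rw [area, area, triangle_rotate]
  have hswap : ∀ x y z : ℍ, area y x z = area x y z := fun x y z => by
    rw [area, area, triangle_swap]
  have hD' : ∀ x y z : ℍ, triDet x y z ≠ 0 → lineDet x y z ≠ 0 := by
    intro x y z h h'
    rw [triDet_eq_lineDet, h', zero_div] at h
    exact h rfl
  have habs : ∀ x y z : ℍ, |areaForm y x z| = |areaForm x y z| := fun x y z => by
    rw [areaForm_swap, abs_neg]
  have h1 : triDet b c a ≠ 0 := by rwa [triDet_rotate]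
  have h2 : triDet c a b ≠ 0 := by rwa [triDet_rotate']
  have h3 : triDet b a c ≠ 0 := by rwa [triDet_swap, neg_ne_zero]
  have h4 : triDet a c b ≠ 0 := by
    rwa [← triDet_rotate, triDet_swap, triDet_rotate, triDet_rotate', neg_ne_zero]
  have h5 : triDet c b a ≠ 0 := by rwa [triDet_swap, neg_ne_zero]
  rcases le_total a.re b.re with hab | hab <;> rcases le_total b.re c.re with hbc | hbc <;>
    rcases le_total a.re c.re with hac | hac
  · exact area_eq_of_sorted hab hbc (hD' _ _ _ hD)
  · exact area_eq_of_sorted hab hbc (hD' _ _ _ hD)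
  · rw [← hrot, ← hrot, ← hswap, area_eq_of_sorted hac hbc (hD' _ _ _ h4), habs,
      ← areaForm_rotate, ← areaForm_rotate]
  · rw [← hrot, ← hrot, area_eq_of_sorted hac hab (hD' _ _ _ h2),
      ← areaForm_rotate, ← areaForm_rotate]
  · rw [← hswap, area_eq_of_sorted hab hac (hD' _ _ _ h3), habs]
  · rw [← hrot, area_eq_of_sorted hbc hac (hD' _ _ _ h1), areaForm_rotate]
  · rw [← hrot, ← hswap, area_eq_of_sorted hbc hab (hD' _ _ _ h5), habs, areaForm_rotate]
  · rw [← hrot, ← hswap, area_eq_of_sorted hbc hab (hD' _ _ _ h5), habs, areaForm_rotate]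

theorem signedArea_eq (a b c : ℍ) : signedArea a b c = areaForm a b c := by
  rw [signedArea, sign_orientation]
  rcases lt_trichotomy (triDet a b c) 0 with h | h | h
  · rw [sign_neg h, area_eq h.ne, abs_of_pos (areaForm_mem_Ioo h).1]
    simp
  · rw [h, areaForm_eq, h]; simp
  · have h' : triDet b a c < 0 := by rw [triDet_swap]; linarith
    have h'' := (areaForm_mem_Ioo h').1
    rw [areaForm_swap] at h''
    rw [sign_pos h, area_eq h.ne', abs_of_neg (by linarith)]
    simp

theorem area_self (a : ℍ) : area a a a = 0 := by
  have : triangle a a a ⊆ {p : ℍ | p.re = a.re} := by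
    intro p hp
    obtain ⟨r, s, t, hr, hs, ht, h1, h2, -⟩ := mem_triangle_iff.1 hp
    change p.re = a.re
    rw [h2, ← add_mul, ← add_mul, h1, one_mul]
  rw [area, Measure.real, measure_mono_null this (volume_re_eq a.re)]
  rfl

/-! ### The volume of a representation with elliptic pants curves -/

variable {m : ℕ}

theorem areaCocycle_eq (A B : G) : areaCocycle A B =
    areaForm UpperHalfPlane.I (A • UpperHalfPlane.I) ((A * B) • UpperHalfPlane.I) :=
  signedArea_eq _ _ _

/-- On the stabilizer of `p`, the area cocycle is the coboundary of the area of the triangle with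
vertices `I`, `A I`, `p`. -/
theorem areaCocycle_eq_of_fix {A B : G} {p : ℍ} (hA : A • p = p) :
    areaCocycle A B = areaForm UpperHalfPlane.I (A • UpperHalfPlane.I) p
      + areaForm UpperHalfPlane.I (B • UpperHalfPlane.I) p
      - areaForm UpperHalfPlane.I ((A * B) • UpperHalfPlane.I) p := by
  have h := areaForm_smul A UpperHalfPlane.I (B • UpperHalfPlane.I) p
  rw [hA] at h
  rw [areaCocycle_eq, ← h, mul_smul]
  simp only [areaForm]
  linarith [arcPrimitive_swap p UpperHalfPlane.I, arcPrimitive_swap p (A • UpperHalfPlane.I),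
    arcPrimitive_swap UpperHalfPlane.I (A • B • UpperHalfPlane.I)]

theorem eq_zero_of_bounded_of_additive {H : Type*} [Group H] {d : H → ℝ} {M : ℝ}
    (hM : ∀ g, |d g| ≤ M) (hd : ∀ g h, d (g * h) = d g + d h) (g : H) : d g = 0 := by
  have hpow : ∀ n : ℕ, d (g ^ n) = n * d g := by
    intro n
    induction n with
    | zero =>
      have := hd 1 1
      rw [mul_one] at this
      simp; linarith
    | succ n ih => rw [pow_succ, hd, ih]; push_cast; ring
  by_contra h
  have hpos : 0 < |d g| := abs_pos.2 h
  obtain ⟨n, hn⟩ := exists_nat_gt (M / |d g|)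
  have h1 := hM (g ^ n)
  rw [hpow, abs_mul, Nat.abs_cast] at h1
  rw [div_lt_iff₀ hpos] at hn
  linarith

/-- Bounded primitives on the cyclic groups `⟨cᵢ⟩` are unique, as a bounded homomorphism to `ℝ` is
zero, so the volume may be computed with the primitives given by the fixed points. -/
theorem isVolume_iff {n : ℕ} {φ : SphereGroup n →* G} {C : Fin n → ℍ}
    (hC : ∀ i, φ (gen i) • C i = C i) {v : ℝ} : IsVolume φ v ↔
    v = (∑ i : Fin n with 0 < i.val, areaCocycle (φ (genProd i.castSucc)) (φ (gen i)))
        + areaCocycle (φ 1) (φ 1)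
        - ∑ i : Fin n, areaForm UpperHalfPlane.I (φ (gen i) • UpperHalfPlane.I) (C i) := by
  have hfix : ∀ i, ∀ g : Subgroup.zpowers (gen i), φ g • C i = C i := by
    intro i g
    have : Subgroup.zpowers (gen i) ≤ (MulAction.stabilizer G (C i)).comap φ := by
      rw [Subgroup.zpowers_le]
      exact hC i
    exact this g.2
  have hcob : ∀ i, ∀ g h : Subgroup.zpowers (gen i), areaCocycle (φ g) (φ h) =
      areaForm UpperHalfPlane.I (φ g • UpperHalfPlane.I) (C i)
      + areaForm UpperHalfPlane.I (φ h • UpperHalfPlane.I) (C i)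
      - areaForm UpperHalfPlane.I
          (φ (g * h : Subgroup.zpowers (gen i)) • UpperHalfPlane.I) (C i) := by
    intro i g h
    rw [areaCocycle_eq_of_fix (hfix i g), Subgroup.coe_mul, map_mul]
  constructor
  · rintro ⟨k, hk, hkc, rfl⟩
    congr 1
    refine Finset.sum_congr rfl fun i _ => ?_
    obtain ⟨M, hM⟩ := hk i
    have := eq_zero_of_bounded_of_additive (M := M + Real.pi)
      (d := fun g : Subgroup.zpowers (gen i) =>
        k i g - areaForm UpperHalfPlane.I (φ g • UpperHalfPlane.I) (C i))
      (fun g => (abs_sub _ _).trans (add_le_add (hM g) (abs_areaForm_le _ _ _)))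
      (fun g h => by linarith [hkc i g h, hcob i g h])
      ⟨gen i, Subgroup.mem_zpowers (gen i)⟩
    linarith
  · rintro rfl
    exact ⟨fun i g => areaForm UpperHalfPlane.I (φ g • UpperHalfPlane.I) (C i),
      fun i => ⟨Real.pi, fun g => abs_areaForm_le _ _ _⟩,
      fun i g h => by linarith [hcob i g h], rfl⟩

theorem genProd_zero {n : ℕ} : genProd (0 : Fin (n + 1)) = 1 := Fin.partialProd_zero _

theorem genProd_succ {n : ℕ} (j : Fin n) : genProd j.succ = genProd j.castSucc * gen j :=
  Fin.partialProd_succ _ j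

theorem genProd_last {n : ℕ} : genProd (Fin.last n) = 1 := by
  have h : PresentedGroup.mk {(List.ofFn (FreeGroup.of : Fin n → FreeGroup (Fin n))).prod}
      (List.ofFn (FreeGroup.of : Fin n → FreeGroup (Fin n))).prod = 1 :=
    PresentedGroup.one_of_mem (Set.mem_singleton _)
  rw [map_list_prod, List.map_ofFn] at h
  rw [genProd, Fin.partialProd, Fin.val_last, List.take_of_length_le (by simp)]
  exact h

/-- The product `c₁ ⋯ c_{j+1}`, for `0 ≤ j ≤ n - 2`, whose image fixes `B_j`. -/
def chainProd (j : Fin (m + 2)) : SphereGroup (m + 3) := genProd j.succ.castSucc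

theorem chainProd_zero : chainProd (0 : Fin (m + 2)) = gen 0 := by
  have h := genProd_succ (0 : Fin (m + 3))
  rw [Fin.castSucc_zero, genProd_zero, one_mul] at h
  exact h

theorem chainProd_succ (i : Fin (m + 1)) :
    chainProd i.succ = chainProd i.castSucc * gen i.castSucc.succ :=
  genProd_succ (i.castSucc.succ)

theorem chainProd_last_mul : chainProd (Fin.last (m + 1)) * gen (Fin.last (m + 2)) = 1 := by
  have h := genProd_succ (Fin.last (m + 2))
  rw [Fin.succ_last, genProd_last] at h
  exact h.symm

theorem curve_eq (j : Fin m) :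
    (curve j : SphereGroup (m + 3)) = (chainProd j.castSucc.succ)⁻¹ := rfl

theorem ptB_zero (x : Config m) : ptB x 0 = x.1 0 := rfl

theorem ptB_last (x : Config m) : ptB x (Fin.last (m + 1)) = x.1 (Fin.last (m + 2)) := by
  change ptB x (Fin.last m).succ = _
  rw [ptB, Fin.cons_succ, Fin.snoc_last]

theorem ptB_castSucc_succ (x : Config m) (j : Fin m) : ptB x j.castSucc.succ = x.2 j := by
  rw [ptB, Fin.cons_succ, Fin.snoc_castSucc]

theorem ptC_eq (x : Config m) (i : Fin (m + 1)) : ptC x i = x.1 i.castSucc.succ := rfl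

theorem angC_eq (α : Fin (m + 3) → ℝ) (i : Fin (m + 1)) : angC α i = α i.castSucc.succ := rfl

theorem IsFixOf.inv {z : ℍ} {A : G} (h : IsFixOf z A) : IsFixOf z A⁻¹ := by
  have e : ∀ w : ℍ, A⁻¹ • w = w ↔ A • w = w := fun w => by rw [inv_smul_eq_iff, eq_comm]
  refine ⟨?_, (e z).2 h.2⟩
  obtain ⟨w, hw, hu⟩ := h.1
  exact ⟨w, (e w).2 hw, fun y hy => hu y ((e y).1 hy)⟩

theorem isFixOf_chainProd {φ : SphereGroup (m + 3) →* G} {x : Config m} (h : IsFixConfig φ x)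
    (i : Fin (m + 2)) : IsFixOf (ptB x i) (φ (chainProd i)) := by
  induction i using Fin.cases with
  | zero => rw [chainProd_zero]; exact h.1 0
  | succ i =>
    induction i using Fin.lastCases with
    | last =>
      have h1 : chainProd (Fin.last (m + 1)) = (gen (Fin.last (m + 2)))⁻¹ :=
        eq_inv_of_mul_eq_one_left chainProd_last_mul
      rw [Fin.succ_last, ptB_last, h1, map_inv]
      exact (h.1 _).inv
    | cast j =>
      have h1 := (h.2 j).inv
      rw [curve_eq, map_inv, inv_inv] at h1
      rw [ptB_castSucc_succ]
      exact h1

theorem sum_chain_telescope (f : Fin (m + 2) → ℝ) :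
    ∑ i : Fin (m + 1), (f i.succ - f i.castSucc) = f (Fin.last (m + 1)) - f 0 := by
  have h1 := Fin.sum_univ_succ f
  have h2 := Fin.sum_univ_castSucc f
  rw [Finset.sum_sub_distrib]
  linarith

theorem sum_filter_val_pos (f : Fin (m + 3) → ℝ) :
    ∑ i : Fin (m + 3) with 0 < i.val, f i = ∑ i : Fin (m + 2), f i.succ := by
  rw [Finset.sum_filter, Fin.sum_univ_succ]
  simp

/-- The volume of a representation is `-2` times the sum of the signed areas of its triangles. -/
theorem isVolume_iff_of_isFixConfig {φ : SphereGroup (m + 3) →* G} {x : Config m}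
    (h : IsFixConfig φ x) {v : ℝ} : IsVolume φ v ↔
      v = -2 * ∑ i : Fin (m + 1), areaForm (ptB x i.castSucc) (ptC x i) (ptB x i.succ) := by
  rw [isVolume_iff (C := x.1) fun i => (h.1 i).2]
  have hB := isFixOf_chainProd h
  have hloc : ∀ i : Fin (m + 1), areaCocycle (φ (chainProd i.castSucc)) (φ (gen i.castSucc.succ)) =
      areaForm UpperHalfPlane.I (φ (chainProd i.castSucc) • UpperHalfPlane.I) (ptB x i.castSucc)
      + areaForm UpperHalfPlane.I (φ (gen i.castSucc.succ) • UpperHalfPlane.I) (x.1 i.castSucc.succ)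
      - areaForm UpperHalfPlane.I (φ (chainProd i.succ) • UpperHalfPlane.I) (ptB x i.succ)
      - 2 * areaForm (ptB x i.castSucc) (ptC x i) (ptB x i.succ) := by
    intro i
    obtain ⟨s, -, h1⟩ := exists_eq_rotAt (hB i.castSucc)
    obtain ⟨t, -, h2⟩ := exists_eq_rotAt (h.1 i.castSucc.succ)
    obtain ⟨u, hu, h3⟩ := exists_eq_rotAt (hB i.succ)
    have hmul : φ (chainProd i.succ) = φ (chainProd i.castSucc) * φ (gen i.castSucc.succ) := by
      rw [chainProd_succ, map_mul]
    have hsin : Real.sin (u / 2) ≠ 0 :=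
      (Real.sin_pos_of_pos_of_lt_pi (by linarith [hu.1]) (by linarith [hu.2])).ne'
    have href := areaForm_reflect (a := ptB x i.castSucc) (b := x.1 i.castSucc.succ)
      (c := ptB x i.succ) (s := s) (t := t) hsin (by rw [← h1, ← h2, ← h3, hmul])
    rw [← h1] at href
    rw [areaCocycle_eq, hmul]
    exact areaForm_hexagon (hB i.castSucc).2 (h.1 i.castSucc.succ).2
      (by rw [← hmul]; exact (hB i.succ).2) href UpperHalfPlane.I
  have hone : areaCocycle (φ 1) (φ 1) = 0 := by
    rw [areaCocycle_eq, map_one]; simp [areaForm, arcPrimitive]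
  have hlast : areaCocycle (φ (chainProd (Fin.last (m + 1)))) (φ (gen (Fin.last (m + 2)))) = 0 := by
    rw [areaCocycle_eq, ← map_mul, chainProd_last_mul, map_one, one_smul, areaForm,
      arcPrimitive_swap UpperHalfPlane.I]
    simp [arcPrimitive]
  have hinv : areaForm UpperHalfPlane.I (φ (chainProd (Fin.last (m + 1))) • UpperHalfPlane.I)
      (ptB x (Fin.last (m + 1))) = -areaForm UpperHalfPlane.I
        (φ (gen (Fin.last (m + 2))) • UpperHalfPlane.I) (x.1 (Fin.last (m + 2))) := by
    have h1 : chainProd (Fin.last (m + 1)) = (gen (Fin.last (m + 2)))⁻¹ :=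
      eq_inv_of_mul_eq_one_left chainProd_last_mul
    have h2 := areaForm_smul (φ (gen (Fin.last (m + 2)))) UpperHalfPlane.I
      ((φ (gen (Fin.last (m + 2))))⁻¹ • UpperHalfPlane.I) (x.1 (Fin.last (m + 2)))
    rw [smul_inv_smul, (h.1 _).2] at h2
    rw [ptB_last, h1, map_inv, ← h2, areaForm_swap]
  have hsum : ∑ i : Fin (m + 3) with 0 < i.val, areaCocycle (φ (genProd i.castSucc)) (φ (gen i)) =
      ∑ i : Fin (m + 3), areaForm UpperHalfPlane.I (φ (gen i) • UpperHalfPlane.I) (x.1 i)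
      - 2 * ∑ i : Fin (m + 1), areaForm (ptB x i.castSucc) (ptC x i) (ptB x i.succ) := by
    rw [sum_filter_val_pos, Fin.sum_univ_castSucc]
    change ∑ i : Fin (m + 1), areaCocycle (φ (chainProd i.castSucc)) (φ (gen i.castSucc.succ)) +
      areaCocycle (φ (chainProd (Fin.last (m + 1)))) (φ (gen (Fin.last (m + 2)))) = _
    have htel := sum_chain_telescope fun i =>
      areaForm UpperHalfPlane.I (φ (chainProd i) • UpperHalfPlane.I) (ptB x i)
    simp only [hinv, chainProd_zero, ptB_zero] at htel
    rw [hlast, Finset.sum_congr rfl fun i _ => hloc i, Fin.sum_univ_succ (n := m + 2),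
      Fin.sum_univ_castSucc (n := m + 1), Finset.mul_sum]
    simp only [Finset.sum_sub_distrib, Finset.sum_add_distrib, Fin.succ_last] at htel ⊢
    linarith
  rw [hsum, hone]
  constructor <;> intro h' <;> rw [h'] <;> ring

/-! ### Chains of triangles -/

theorem sum_filter_lt_succ {N : ℕ} (f : Fin N → ℝ) (k : Fin N) :
    ∑ j : Fin N with j.val < k.val + 1, f j = ∑ j : Fin N with j.val < k.val, f j + f k := by
  have : (Finset.univ.filter fun j : Fin N => j.val < k.val + 1) =
      insert k (Finset.univ.filter fun j : Fin N => j.val < k.val) := by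
    ext j
    simp only [Finset.mem_filter, Finset.mem_univ, true_and, Finset.mem_insert, Fin.ext_iff]
    omega
  rw [this, Finset.sum_insert (by simp), add_comm]

theorem beta_zero (α : Fin (m + 3) → ℝ) (x : Config m) : beta α x 0 = 2 * Real.pi - α 0 := rfl

theorem beta_last (α : Fin (m + 3) → ℝ) (x : Config m) :
    beta α x (Fin.last (m + 1)) = α (Fin.last (m + 2)) := by
  change beta α x (Fin.last m).succ = _
  rw [beta, Fin.cons_succ, Fin.snoc_last]

/-- The formula defining `β_{i+1}` holds for `β₀` as well. -/
theorem beta_castSucc (α : Fin (m + 3) → ℝ) (x : Config m) (i : Fin (m + 1)) :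
    beta α x i.castSucc = (∑ j : Fin (m + 1) with j.val < i.val, 2 * chainArea x j)
      - (∑ j : Fin (m + 3) with j.val < i.val + 1, α j) + 2 * ((i.val : ℝ) + 1) * Real.pi := by
  induction i using Fin.cases with
  | zero =>
    have h := sum_filter_lt_succ α 0
    simp only [Fin.val_zero, zero_add, not_lt_zero, Finset.filter_false, Finset.sum_empty] at h
    simp only [Fin.castSucc_zero, beta_zero, Fin.val_zero, zero_add, h, not_lt_zero,
      Finset.filter_false, Finset.sum_empty]
    push_cast
    ring
  | succ i =>
    rw [beta, ← Fin.succ_castSucc, Fin.cons_succ, Fin.snoc_castSucc]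
    simp only [Fin.val_succ, Nat.lt_succ_iff]
    push_cast
    ring_nf

theorem beta_step (α : Fin (m + 3) → ℝ) (x : Config m) (i : Fin m) :
    beta α x i.castSucc.succ = beta α x i.castSucc.castSucc + 2 * chainArea x i.castSucc
      - angC α i.castSucc + 2 * Real.pi := by
  have h1 := beta_castSucc α x i.castSucc
  have h2 := beta_castSucc α x i.succ
  have h3 := sum_filter_lt_succ (fun j => 2 * chainArea x j) i.castSucc
  have h4 := sum_filter_lt_succ α i.castSucc.castSucc.succ
  simp only [Fin.val_castSucc, Fin.val_succ] at h1 h2 h3 h4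
  rw [Fin.succ_castSucc, h2, h1, h3, h4, angC_eq]
  have : (i.castSucc.castSucc.succ : Fin (m + 3)) = i.castSucc.castSucc.succ := rfl
  push_cast
  ring

theorem rotAt_add_two_pi (z : ℍ) (θ : ℝ) : rotAt z (θ + 2 * Real.pi) = rotAt z θ := by
  rw [rotAt, rotAt, mk_eq_mk_iff]
  right
  change rotMat z _ = -rotMat z _
  rw [← rotMat_add_pi]
  congr 1
  ring

theorem rotAt_angle_unique {z : ℍ} {s t : ℝ} (hs : s ∈ Set.Ioo 0 (2 * Real.pi))
    (ht : t ∈ Set.Ioo 0 (2 * Real.pi)) (h : rotAt z s = rotAt z t) : s = t := by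
  have hz := z.im_pos
  have hs' : 0 < Real.sin (s / 2) :=
    Real.sin_pos_of_pos_of_lt_pi (by linarith [hs.1]) (by linarith [hs.2])
  have ht' : 0 < Real.sin (t / 2) :=
    Real.sin_pos_of_pos_of_lt_pi (by linarith [ht.1]) (by linarith [ht.2])
  have htr : ∀ r : ℝ, (rotMat z r) 0 0 + (rotMat z r) 1 1 = 2 * Real.cos r := fun r => by
    rw [← trace_rotMat z r, Matrix.trace_fin_two]
  have hent : ∀ r : ℝ, (rotMat z r) 1 0 = -(Real.sin r * (1 / z.im)) := fun r => by
    simp [rotMat, complexStr]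
  have hcos : Real.cos (s / 2) = Real.cos (t / 2) := by
    rcases mk_eq_mk_iff.1 h with h | h
    · have h1 : rotMat z (s / 2) = rotMat z (t / 2) := h
      have h2 := htr (s / 2)
      rw [h1, htr] at h2
      linarith
    · exfalso
      have h1 : rotMat z (s / 2) = -rotMat z (t / 2) := h
      have h2 := hent (s / 2)
      rw [h1, Matrix.neg_apply, hent] at h2
      have : 0 < 1 / z.im := by positivity
      nlinarith [mul_pos hs' this, mul_pos ht' this]
  have := Real.injOn_cos ⟨by linarith [hs.1], by linarith [hs.2]⟩
    ⟨by linarith [ht.1], by linarith [ht.2]⟩ hcos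
  linarith

theorem TriangleRel.area_eq {a b c : ℍ} {p q r : ℝ} (h : TriangleRel a b c p q r)
    (hp : p ∈ Set.Ioo 0 Real.pi) (hq : q ∈ Set.Ioo 0 Real.pi) (hr : r ∈ Set.Ioo 0 Real.pi) :
    area a b c = areaForm a b c := by
  rcases h.eq_or_triDet_neg (Real.sin_pos_of_mem_Ioo hp) (Real.sin_pos_of_mem_Ioo hq)
    (Real.sin_pos_of_mem_Ioo hr) with ⟨rfl, rfl⟩ | hD
  · rw [area_self, areaForm]; simp [arcPrimitive]
  · rw [DeroinTholozan.area_eq hD.ne, abs_of_pos (areaForm_mem_Ioo hD).1]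

theorem half_mem_Ioo {t : ℝ} (h : t ∈ Set.Ioo 0 (2 * Real.pi)) : t / 2 ∈ Set.Ioo 0 Real.pi :=
  ⟨by linarith [h.1], by linarith [h.2]⟩

theorem pi_sub_half_mem_Ioo {t : ℝ} (h : t ∈ Set.Ioo 0 (2 * Real.pi)) :
    Real.pi - t / 2 ∈ Set.Ioo 0 Real.pi := ⟨by linarith [h.2], by linarith [h.1]⟩

/-- The triangles of the configuration satisfy the relations of rotations of angles `-b_i`,
`α_{i+2}` and `b_{i+1}` whose product is `-1` on the lifts. -/
def ChainRel (α : Fin (m + 3) → ℝ) (b : Fin (m + 2) → ℝ) (x : Config m) : Prop :=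
  ∀ i : Fin (m + 1), TriangleRel (ptB x i.castSucc) (ptC x i) (ptB x i.succ) (b i.castSucc / 2)
    (Real.pi - angC α i / 2) (Real.pi - b i.succ / 2)

theorem ChainRel.two_mul_areaForm {α : Fin (m + 3) → ℝ} {b : Fin (m + 2) → ℝ} {x : Config m}
    (h : ChainRel α b x) (hα : ∀ i, α i ∈ Set.Ioo 0 (2 * Real.pi))
    (hb : ∀ i, b i ∈ Set.Ioo 0 (2 * Real.pi)) (i : Fin (m + 1)) :
    2 * areaForm (ptB x i.castSucc) (ptC x i) (ptB x i.succ) =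
      angC α i + (b i.succ - b i.castSucc) - 2 * Real.pi := by
  rw [(h i).areaForm_eq (half_mem_Ioo (hb _)) (pi_sub_half_mem_Ioo (hα _))
    (pi_sub_half_mem_Ioo (hb _))]
  ring

theorem ChainRel.chainArea_eq {α : Fin (m + 3) → ℝ} {b : Fin (m + 2) → ℝ} {x : Config m}
    (h : ChainRel α b x) (hα : ∀ i, α i ∈ Set.Ioo 0 (2 * Real.pi))
    (hb : ∀ i, b i ∈ Set.Ioo 0 (2 * Real.pi)) (i : Fin (m + 1)) :
    chainArea x i = areaForm (ptB x i.castSucc) (ptC x i) (ptB x i.succ) :=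
  (h i).area_eq (half_mem_Ioo (hb _)) (pi_sub_half_mem_Ioo (hα _)) (pi_sub_half_mem_Ioo (hb _))

theorem sum_angles_eq (α : Fin (m + 3) → ℝ) :
    ∑ i, α i = α 0 + ∑ i, angC α i + α (Fin.last (m + 2)) := by
  rw [Fin.sum_univ_succ (n := m + 2), Fin.sum_univ_castSucc (n := m + 1), Fin.succ_last]
  simp only [angC_eq]
  ring

theorem sum_defect (α : Fin (m + 3) → ℝ) {b : Fin (m + 2) → ℝ} (h0 : b 0 = 2 * Real.pi - α 0)
    (hl : b (Fin.last (m + 1)) = α (Fin.last (m + 2))) :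
    ∑ i : Fin (m + 1), (angC α i + (b i.succ - b i.castSucc) - 2 * Real.pi) = scalingFactor α := by
  rw [Finset.sum_sub_distrib, Finset.sum_add_distrib, sum_chain_telescope, h0, hl, scalingFactor,
    sum_angles_eq]
  simp
  ring

/-- The angles of the rotations are determined by the areas of the triangles. -/
theorem ChainRel.eq_beta {α : Fin (m + 3) → ℝ} {b : Fin (m + 2) → ℝ} {x : Config m}
    (h : ChainRel α b x) (hα : ∀ i, α i ∈ Set.Ioo 0 (2 * Real.pi))
    (hb : ∀ i, b i ∈ Set.Ioo 0 (2 * Real.pi)) (h0 : b 0 = 2 * Real.pi - α 0)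
    (hl : b (Fin.last (m + 1)) = α (Fin.last (m + 2))) : b = beta α x := by
  have key : ∀ i : Fin (m + 1), b i.castSucc = beta α x i.castSucc := by
    intro i
    induction i using Fin.induction with
    | zero => rw [Fin.castSucc_zero, beta_zero, h0]
    | succ i ih =>
      rw [← Fin.succ_castSucc, beta_step, ← ih, h.chainArea_eq hα hb, h.two_mul_areaForm hα hb]
      ring
  funext i
  induction i using Fin.lastCases with
  | last => rw [hl, beta_last]
  | cast i => exact key i

theorem ChainRel.isAdmissible {α : Fin (m + 3) → ℝ} {x : Config m}
    (h : ChainRel α (beta α x) x) (hα : ∀ i, α i ∈ Set.Ioo 0 (2 * Real.pi))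
    (hb : ∀ i, beta α x i ∈ Set.Ioo 0 (2 * Real.pi)) : IsAdmissible α x := by
  have hp := fun i => half_mem_Ioo (hb i)
  have hq := fun i => pi_sub_half_mem_Ioo (hα i)
  have hr := fun i => pi_sub_half_mem_Ioo (hb i)
  have hor := fun i => (h i).eq_or_triDet_neg (Real.sin_pos_of_mem_Ioo (hp _))
    (Real.sin_pos_of_mem_Ioo (hq _)) (Real.sin_pos_of_mem_Ioo (hr _))
  refine ⟨?_, ?_, ?_⟩
  · intro i hi
    rcases hor i with ⟨h1, h2⟩ | hD
    · exfalso
      rw [chainArea, ← h2, ← h1, area_self] at hi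
      exact lt_irrefl _ hi
    · exact ⟨isClockwise_iff.2 hD, (h i).interiorAngle_eq (hp _) (hq _) (hr _) hD,
        (h i).rotate.interiorAngle_eq (hq _) (hr _) (hp _) (by rwa [triDet_rotate]),
        (h i).rotate.rotate.interiorAngle_eq (hr _) (hp _) (hq _) (by rwa [triDet_rotate'])⟩
  · intro i hi
    rcases hor i with h1 | hD
    · exact h1
    · exfalso
      rw [h.chainArea_eq hα hb] at hi
      exact (areaForm_mem_Ioo hD).1.ne' hi
  · intro hi
    have h1 := h.two_mul_areaForm hα hb (Fin.last m)
    rw [← h.chainArea_eq hα hb, hi] at h1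
    linarith

theorem chainArea_nonneg (x : Config m) (i : Fin (m + 1)) : 0 ≤ chainArea x i :=
  MeasureTheory.measureReal_nonneg

/-- At a triangle reduced to a point, `β_{i+1} = β_i - α_{i+2} + 2π`: for the last triangle this is
the end condition, for the others the definition of `β`. -/
theorem IsAdmissible.step {α : Fin (m + 3) → ℝ} {x : Config m} (h : IsAdmissible α x)
    {i : Fin (m + 1)} (hi : chainArea x i = 0) :
    beta α x i.succ = beta α x i.castSucc - angC α i + 2 * Real.pi := by
  induction i using Fin.lastCases with
  | last => linarith [h.closing hi]
  | cast i => rw [beta_step, hi]; ring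

theorem IsAdmissible.angles_mem {α : Fin (m + 3) → ℝ} {x : Config m} (h : IsAdmissible α x)
    {i : Fin (m + 1)} (hi : 0 < chainArea x i) :
    beta α x i.castSucc ∈ Set.Ioo 0 (2 * Real.pi) ∧ beta α x i.succ ∈ Set.Ioo 0 (2 * Real.pi) := by
  obtain ⟨hcl, h1, -, h3⟩ := h.nondegenerate i hi
  have hD := isClockwise_iff.1 hcl
  have e1 := interiorAngle_mem_Ioo hD.ne
  have e3 := interiorAngle_mem_Ioo (a := ptB x i.succ) (b := ptB x i.castSucc) (c := ptC x i)
    (by rw [triDet_rotate']; exact hD.ne)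
  rw [h1] at e1
  rw [h3] at e3
  exact ⟨⟨by linarith [e1.1], by linarith [e1.2]⟩, ⟨by linarith [e3.2], by linarith [e3.1]⟩⟩

/-- Positivity propagates from `β₀` upwards and the upper bound from `β_{n-2}` downwards, as `β`
increases at triangles reduced to a point. -/
theorem IsAdmissible.beta_mem {α : Fin (m + 3) → ℝ} {x : Config m} (h : IsAdmissible α x)
    (hα : ∀ i, α i ∈ Set.Ioo 0 (2 * Real.pi)) (i : Fin (m + 2)) :
    beta α x i ∈ Set.Ioo 0 (2 * Real.pi) := by
  constructor
  · induction i using Fin.induction with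
    | zero => rw [beta_zero]; linarith [(hα 0).2]
    | succ i ih =>
      rcases eq_or_lt_of_le (chainArea_nonneg x i) with hi | hi
      · rw [h.step hi.symm, angC_eq]; linarith [(hα i.castSucc.succ).2]
      · exact (h.angles_mem hi).2.1
  · induction i using Fin.reverseInduction with
    | last => rw [beta_last]; exact (hα _).2
    | cast i ih =>
      rcases eq_or_lt_of_le (chainArea_nonneg x i) with hi | hi
      · have := h.step hi.symm
        rw [angC_eq] at this
        linarith [(hα i.castSucc.succ).2]
      · exact (h.angles_mem hi).1.2

theorem IsAdmissible.chainRel {α : Fin (m + 3) → ℝ} {x : Config m} (h : IsAdmissible α x) :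
    ChainRel α (beta α x) x := by
  intro i
  rcases eq_or_lt_of_le (chainArea_nonneg x i) with hi | hi
  · obtain ⟨h1, h2⟩ := h.degenerate i hi.symm
    rw [h.step hi.symm, TriangleRel, ← h2, ← h1, rotMat_mul, rotMat_mul]
    have : -(beta α x i.castSucc / 2) + -(Real.pi - angC α i / 2) +
        -(Real.pi - (beta α x i.castSucc - angC α i + 2 * Real.pi) / 2) = 0 - Real.pi := by ring
    rw [this, rotMat_sub_pi, rotMat_zero]
  · obtain ⟨hcl, h1, h2, h3⟩ := h.nondegenerate i hi
    have := triangleRel_interiorAngle (isClockwise_iff.1 hcl)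
    rwa [h1, h2, h3] at this

theorem isAdmissible_iff {α : Fin (m + 3) → ℝ} {x : Config m}
    (hα : ∀ i, α i ∈ Set.Ioo 0 (2 * Real.pi)) : IsAdmissible α x ↔
      ∃ b : Fin (m + 2) → ℝ, (∀ i, b i ∈ Set.Ioo 0 (2 * Real.pi)) ∧ b 0 = 2 * Real.pi - α 0 ∧
        b (Fin.last (m + 1)) = α (Fin.last (m + 2)) ∧ ChainRel α b x := by
  constructor
  · exact fun h => ⟨beta α x, h.beta_mem hα, beta_zero α x, beta_last α x, h.chainRel⟩
  · rintro ⟨b, hb, h0, hl, h⟩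
    obtain rfl := h.eq_beta hα hb h0 hl
    exact h.isAdmissible hα hb

/-! ### From representations to chains and back -/

/-- The sum of the defects `2 S_i - (α_{i+2} + b_{i+1} - b_i - 2π)`, which are `0` or `2π`, is zero
by the volume condition, so all the triangles are clockwise or reduced to a point. -/
theorem isAdmissible_of_isDT {α : Fin (m + 3) → ℝ} {x : Config m}
    (hα : ∀ i, α i ∈ Set.Ioo 0 (2 * Real.pi)) {φ : SphereGroup (m + 3) →* G} (hφ : IsDT α φ)
    (hx : IsFixConfig φ x) : IsAdmissible α x := by
  have hgen : ∀ i, φ (gen i) = rotAt (x.1 i) (α i) := fun i =>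
    eq_rotAt_of_hasAngle (hφ.1 i) (hx.1 i)
  -- The fixed points of the curves make every `φ (chainProd i)` a rotation, with an angle not yet
  -- known.
  have hex : ∀ i, ∃ t ∈ Set.Ioo 0 (2 * Real.pi), φ (chainProd i) = rotAt (ptB x i) (-t) := by
    intro i
    obtain ⟨t, ht, h⟩ := exists_eq_rotAt (isFixOf_chainProd hx i).inv
    exact ⟨t, ht, by rw [rotAt_neg, ← h, inv_inv]⟩
  choose b hb hrot using hex
  have h0 : b 0 = 2 * Real.pi - α 0 := by
    have h1 := hrot 0
    rw [chainProd_zero, hgen, ptB_zero, rotAt_neg, eq_comm, inv_eq_iff_eq_inv, ← rotAt_neg,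
      ← rotAt_add_two_pi (x.1 0) (-α 0)] at h1
    have := rotAt_angle_unique (hb 0) ⟨by linarith [(hα 0).2], by linarith [(hα 0).1]⟩ h1
    linarith
  have hl : b (Fin.last (m + 1)) = α (Fin.last (m + 2)) := by
    have h1 := hrot (Fin.last (m + 1))
    rw [eq_inv_of_mul_eq_one_left chainProd_last_mul, map_inv, hgen, ptB_last, rotAt_neg,
      inv_inj] at h1
    exact (rotAt_angle_unique (hα _) (hb _) h1).symm
  have hmul : ∀ i : Fin (m + 1), rotAt (ptB x i.castSucc) (-b i.castSucc) *
      rotAt (ptC x i) (angC α i) = rotAt (ptB x i.succ) (-b i.succ) := by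
    intro i
    rw [← hrot, ← hrot, ptC_eq, angC_eq, ← hgen, ← map_mul, chainProd_succ]
  -- On the lifts the equation holds up to a sign. One sign is the relation of a clockwise triangle;
  -- the other is that of an anticlockwise one, whose area is determined by Gauss-Bonnet.
  have hdef : ∀ i : Fin (m + 1), TriangleRel (ptB x i.castSucc) (ptC x i) (ptB x i.succ)
      (b i.castSucc / 2) (Real.pi - angC α i / 2) (Real.pi - b i.succ / 2) ∨
      2 * areaForm (ptB x i.castSucc) (ptC x i) (ptB x i.succ) =
        angC α i + (b i.succ - b i.castSucc) := by
    intro i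
    refine (triangleRel_or_of_rotAt_mul_eq (hmul i)).imp_right fun h => ?_
    have h1 := h.areaForm_eq (half_mem_Ioo (hα _)) (pi_sub_half_mem_Ioo (hb _))
      (half_mem_Ioo (hb _))
    rw [areaForm_swap] at h1
    linarith
  have hle : ∀ i ∈ Finset.univ, angC α i + (b i.succ - b i.castSucc) - 2 * Real.pi ≤
      2 * areaForm (ptB x i.castSucc) (ptC x i) (ptB x i.succ) := by
    intro i _
    rcases hdef i with h | h
    · rw [h.areaForm_eq (half_mem_Ioo (hb _)) (pi_sub_half_mem_Ioo (hα _))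
        (pi_sub_half_mem_Ioo (hb _))]
      linarith
    · rw [h]; linarith [Real.pi_pos]
  have hvol := (isVolume_iff_of_isFixConfig hx).1 hφ.2
  -- Both sides of the inequalities `hle` have the sum `scalingFactor α`, so all of them are
  -- equalities.
  have heq := (Finset.sum_eq_sum_iff_of_le hle).1 (by
    rw [sum_defect α h0 hl, ← Finset.mul_sum]; linarith)
  refine (isAdmissible_iff hα).2 ⟨b, hb, h0, hl, fun i => ?_⟩
  refine (hdef i).resolve_right fun h => ?_
  have := heq i (Finset.mem_univ i)
  rw [h] at this
  linarith [Real.pi_pos]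

/-- The relations of the triangles compose: the product of the first `i + 1` rotations around the
points `C_j` is the rotation of angle `-β_i` around `B_i`. -/
theorem partialProd_rotAt {α : Fin (m + 3) → ℝ} {x : Config m} (h : IsAdmissible α x)
    (i : Fin (m + 2)) :
    Fin.partialProd (fun j => rotAt (x.1 j) (α j)) i.succ.castSucc =
      rotAt (ptB x i) (-beta α x i) := by
  induction i using Fin.induction with
  | zero =>
    have h1 := Fin.partialProd_succ (fun j => rotAt (x.1 j) (α j)) (0 : Fin (m + 3))
    rw [Fin.castSucc_zero, Fin.partialProd_zero, one_mul] at h1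
    have h2 : rotAt (ptB x 0) (-beta α x 0) = rotAt (x.1 0) (α 0) := by
      rw [beta_zero, ptB_zero, ← rotAt_add_two_pi]
      congr 1
      ring
    rw [h2]
    exact h1
  | succ i ih =>
    have h1 := Fin.partialProd_succ (fun j => rotAt (x.1 j) (α j)) i.castSucc.succ
    rw [ih] at h1
    exact h1.trans (rotAt_mul_eq_of_triangleRel (h.chainRel i))

theorem exists_isDT_of_isAdmissible {α : Fin (m + 3) → ℝ} {x : Config m}
    (hα : ∀ i, α i ∈ Set.Ioo 0 (2 * Real.pi)) (h : IsAdmissible α x) :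
    ∃ φ : SphereGroup (m + 3) →* G, IsDT α φ ∧ IsFixConfig φ x := by
  have hrel : ∀ r ∈ ({(List.ofFn (FreeGroup.of : Fin (m + 3) → FreeGroup (Fin (m + 3)))).prod} :
      Set (FreeGroup (Fin (m + 3)))), FreeGroup.lift (fun j => rotAt (x.1 j) (α j)) r = 1 := by
    rintro r rfl
    rw [map_list_prod, List.map_ofFn]
    have h1 := Fin.partialProd_succ (fun j => rotAt (x.1 j) (α j)) (Fin.last (m + 2))
    have h2 := partialProd_rotAt h (Fin.last (m + 1))
    rw [Fin.succ_last] at h2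
    rw [h2, ptB_last, beta_last, rotAt_neg, inv_mul_cancel, Fin.succ_last, Fin.partialProd,
      Fin.val_last, List.take_of_length_le (by simp)] at h1
    rw [← h1]
    congr 2
    funext j
    simp
  let φ : SphereGroup (m + 3) →* G := PresentedGroup.toGroup hrel
  have hgen : ∀ i, φ (gen i) = rotAt (x.1 i) (α i) := fun i => PresentedGroup.toGroup.of hrel
  have hprod : ∀ i, φ (chainProd i) = rotAt (ptB x i) (-beta α x i) := by
    intro i
    rw [← partialProd_rotAt h, chainProd, genProd, Fin.partialProd, Fin.partialProd, map_list_prod,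
      List.map_take, List.map_ofFn]
    congr 3
    exact funext hgen
  have hfix : IsFixConfig φ x := by
    refine ⟨fun i => by rw [hgen]; exact isFixOf_rotAt (hα i), fun j => ?_⟩
    rw [curve_eq, map_inv, hprod, ← rotAt_neg, neg_neg, ptB_castSucc_succ]
    exact isFixOf_rotAt (h.beta_mem hα _)
  refine ⟨φ, ⟨fun i => by rw [hgen]; exact hasAngle_rotAt (hα i), ?_⟩, hfix⟩
  rw [isVolume_iff_of_isFixConfig hfix, ← sum_defect α (beta_zero α x) (beta_last α x), neg_mul,
    Finset.mul_sum]
  congr 1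
  exact Finset.sum_congr rfl fun i _ =>
    (h.chainRel.two_mul_areaForm hα (h.beta_mem hα) i).symm

theorem eq_of_isDT_of_isFixConfig {α : Fin (m + 3) → ℝ} {x : Config m}
    {φ ψ : SphereGroup (m + 3) →* G} (hφ : IsDT α φ) (hψ : IsDT α ψ) (hφx : IsFixConfig φ x)
    (hψx : IsFixConfig ψ x) : φ = ψ := by
  apply PresentedGroup.ext
  intro i
  exact (eq_rotAt_of_hasAngle (hφ.1 i) (hφx.1 i)).trans
    (eq_rotAt_of_hasAngle (hψ.1 i) (hψx.1 i)).symm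

/-! ### Conjugation -/

theorem IsFixOf.conj {z : ℍ} {A : G} (h : IsFixOf z A) (B : G) : IsFixOf (B • z) (B * A * B⁻¹) := by
  have e : ∀ w : ℍ, (B * A * B⁻¹) • w = w ↔ A • (B⁻¹ • w) = B⁻¹ • w := fun w => by
    rw [mul_smul, mul_smul, ← eq_inv_smul_iff]
  refine ⟨?_, by rw [e, inv_smul_smul]; exact h.2⟩
  obtain ⟨w, hw, hu⟩ := h.1
  refine ⟨B • w, by simp only [e, inv_smul_smul]; exact hw, fun y hy => ?_⟩
  rw [← hu _ ((e y).1 hy), smul_inv_smul]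

theorem HasAngle.conj {A : G} {θ : ℝ} (h : HasAngle A θ) (B : G) : HasAngle (B * A * B⁻¹) θ :=
  ⟨h.1, h.2.trans (isConj_iff.2 ⟨B, rfl⟩)⟩

theorem IsFixConfig.conj {φ ψ : SphereGroup (m + 3) →* G} {x : Config m} (h : IsFixConfig φ x)
    {B : G} (hψ : ∀ y, ψ y = B * φ y * B⁻¹) : IsFixConfig ψ (B • x) :=
  ⟨fun i => by rw [hψ]; exact (h.1 i).conj B, fun j => by rw [hψ]; exact (h.2 j).conj B⟩

theorem ptB_smul (B : G) (x : Config m) (i : Fin (m + 2)) : ptB (B • x) i = B • ptB x i := by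
  induction i using Fin.cases with
  | zero => rfl
  | succ i =>
    induction i using Fin.lastCases with
    | last => rw [Fin.succ_last, ptB_last, ptB_last]; rfl
    | cast j => rw [ptB_castSucc_succ, ptB_castSucc_succ]; rfl

theorem IsDT.conj {α : Fin (m + 3) → ℝ} {φ ψ : SphereGroup (m + 3) →* G} {x : Config m}
    (h : IsDT α φ) (hx : IsFixConfig φ x) {B : G} (hψ : ∀ y, ψ y = B * φ y * B⁻¹) : IsDT α ψ := by
  refine ⟨fun i => by rw [hψ]; exact (h.1 i).conj B, ?_⟩
  rw [isVolume_iff_of_isFixConfig (hx.conj hψ), (isVolume_iff_of_isFixConfig hx).1 h.2]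
  congr 1
  refine Finset.sum_congr rfl fun i _ => ?_
  rw [ptB_smul, ptB_smul, ← areaForm_smul B]
  rfl

theorem exists_conj (φ : SphereGroup (m + 3) →* G) (B : G) :
    ∃ ψ : SphereGroup (m + 3) →* G, ∀ y, ψ y = B * φ y * B⁻¹ :=
  ⟨(MulAut.conj B).toMonoidHom.comp φ, fun _ => rfl⟩

/-- Both conjugacy and isometry may be absorbed in the choice of the representation. -/
theorem mem_repDT_and_fixClass_iff {α : Fin (m + 3) → ℝ} {x : Config m} {r : Rep (m + 3)} :
    (r ∈ RepDT α ∧ FixClass r (Moduli.mk x)) ↔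
      ∃ φ, Rep.mk φ = r ∧ IsDT α φ ∧ IsFixConfig φ x := by
  constructor
  · rintro ⟨⟨φ, rfl, hφ⟩, ψ, x', hψ, hx', hfix⟩
    obtain ⟨A, hA⟩ : ∃ A : G, A • x' = x := Quotient.exact hx'.symm
    obtain ⟨B, hB⟩ : ∃ B : G, ∀ y, φ y = B * ψ y * B⁻¹ := Quotient.exact hψ
    obtain ⟨χ, hχ⟩ := exists_conj ψ A
    have hfix' := hfix.conj hB
    have hχ' : ∀ y, χ y = (A * B⁻¹) * φ y * (A * B⁻¹)⁻¹ := by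
      intro y; rw [hχ, hB]; group
    refine ⟨χ, ?_, hφ.conj hfix' hχ', by rw [← hA]; exact hfix.conj hχ⟩
    exact (Quotient.sound (s := conjSetoid (m + 3)) ⟨_, hχ'⟩ : Rep.mk φ = Rep.mk χ).symm
  · rintro ⟨φ, rfl, hφ, hx⟩
    exact ⟨⟨φ, rfl, hφ⟩, φ, x, rfl, rfl, hx⟩

end DeroinTholozan

theorem lemma3p6 (m : ℕ) (α : Fin (m + 3) → ℝ)
    (hα : ∀ i, α i ∈ Set.Ioo 0 (2 * Real.pi))
    (hsum : 2 * Real.pi * (((m + 3 : ℕ) : ℝ) - 1) < ∑ i, α i)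
    (x : DeroinTholozan.Config m) :
    (DeroinTholozan.Moduli.mk x ∈ DeroinTholozan.ChTri α ↔ DeroinTholozan.IsAdmissible α x) ∧
    (DeroinTholozan.IsAdmissible α x →
      ∃! r : DeroinTholozan.Rep (m + 3), r ∈ DeroinTholozan.RepDT α ∧
        DeroinTholozan.FixClass r (DeroinTholozan.Moduli.mk x)) := by
  refine ⟨⟨?_, ?_⟩, ?_⟩
  · rintro ⟨r, hr, hr'⟩
    obtain ⟨φ, -, hφ, hx⟩ := DeroinTholozan.mem_repDT_and_fixClass_iff.1 ⟨hr, hr'⟩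
    exact DeroinTholozan.isAdmissible_of_isDT hα hφ hx
  · intro h
    obtain ⟨φ, hφ, hx⟩ := DeroinTholozan.exists_isDT_of_isAdmissible hα h
    exact ⟨_, DeroinTholozan.mem_repDT_and_fixClass_iff.2 ⟨φ, rfl, hφ, hx⟩⟩
  · intro h
    obtain ⟨φ, hφ, hx⟩ := DeroinTholozan.exists_isDT_of_isAdmissible hα h
    refine ⟨_, DeroinTholozan.mem_repDT_and_fixClass_iff.2 ⟨φ, rfl, hφ, hx⟩, ?_⟩
    intro r hr
    obtain ⟨ψ, rfl, hψ, hψx⟩ := DeroinTholozan.mem_repDT_and_fixClass_iff.1 hr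
    rw [DeroinTholozan.eq_of_isDT_of_isFixConfig hψ hφ hψx hx]
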